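/- Let $H,H'$ be complex Hilbert spaces (of arbitrary dimension). A density operator (state) is a positive operator of trace one. For states $\tau,\sigma$ the relative entropy is $S(\tau,\sigma)=\operatorname{tr}\tau(\log\tau-\log\sigma)\in[0,\infty]$ if $\overline{\operatorname{ran}\tau}\subseteq\overline{\operatorname{ran}\sigma}$, and $S(\tau,\sigma)=\infty$ otherwise; in infinite dimension, with spectral decompositions $\tau=\sum_a aP_a$ and $\sigma=\sum_b bQ_b$ (including the eigenvalue $0$), the trace is understood as $\sum_{a,b}\operatorname{tr}(P_aQ_b)\,(a\log a-a\log b+b-a)$, all of whose terms are nonnegative. The von Neumann entropy is $S(\tau)=-\operatorname{tr}\tau\log\tau\in[0,\infty]$. Throughout $0\log 0=0$ and $0\cdot\infty=0$. A map $\Lambda^*$ from the states on $H$ to the states on $H'$ is a completely positive channel if it has a (linear) dual map $\Lambda:B(H')\to B(H)$, $\operatorname{tr}(\Lambda^*(\tau)B)=\operatorname{tr}(\tau\Lambda(B))$, such that $\sum_{k,j=1}^nA_k^*\Lambda(B_k^*B_j)A_j\ge0$ for all $n$, $A_j\in B(H)$, $B_k\in B(H')$. Let $\rho=\{\lambda_k\}$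 be a probability distribution (a family of numbers $\lambda_k\ge0$ with $\sum_k\lambda_k=1$), let $\sigma_k$ be states on $H$ (a quantum coding), let $\Xi^*$ be the map sending a probability distribution $\{\mu_k\}$ to $\sum_k\mu_k\sigma_k$, and put $\sigma=\Xi^*\rho=\sum_k\lambda_k\sigma_k$. For a map $\Lambda^*$ from probability distributions to states, the mutual entropy is $I(\rho;\Lambda^*)=\sup\sum_jw_jS(\Lambda^*e_j,\Lambda^*\rho)$, the supremum being over all Schatten decompositions $\rho=\sum_jw_je_j$, $w_j\ge0$, of $\rho$ into distinct point masses $e_j$. Theorem. (1) Let $\{E_i\}$ be a projection-valued measure on $H'$, i.e. a family of mutually orthogonal orthogonal projections with $\sum_iE_i=1$ strongly, let $\Gamma_1^*\tau=\sum_iE_i\tau E_i$, let $\Gamma_2^*$ be a completely positive channel from $H$ to $H'$, and let $\Gamma^*=\Gamma_1^*\circ\Gamma_2^*$. Then, in $[0,\infty]$, $$\sum_k\lambda_kS(\sigma_k,\sigma)\ \ge\ I(\rho;\Gamma^*\circ\Xi^*)=\sum_k\lambda_kS(\Gamma^*\sigma_k,\Gamma^*\sigma)$$ $$\ge\ \sum_i\Big[-\operatorname{tr}(\Gamma_2^*\sigma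 E_i)\log\operatorname{tr}(\Gamma_2^*\sigma E_i)+\sum_k\lambda_k\operatorname{tr}(\Gamma_2^*\sigma_kE_i)\log\operatorname{tr}(\Gamma_2^*\sigma_kE_i)\Big],$$ where for each $i$ the inner sum over $k$ converges absolutely and the bracket is nonnegative. (2) (Case of trivial $\Gamma_2^*$: the Holevo bound.) One has $\sum_k\lambda_kS(\sigma_k,\sigma)+\sum_k\lambda_kS(\sigma_k)=S(\sigma)$ in $[0,\infty]$, so that $\sum_k\lambda_kS(\sigma_k,\sigma)=S(\sigma)-\sum_k\lambda_kS(\sigma_k)$ whenever $\sum_k\lambda_kS(\sigma_k)<\infty$; and for every projection-valued measure $\{E_i\}$ on $H$, with $\Gamma_1^*$ the corresponding pinching, $$\sum_k\lambda_kS(\sigma_k,\sigma)\ \ge\ I(\rho;\Gamma_1^*\circ\Xi^*)\ \ge\ \sum_i\Big[-\operatorname{tr}(\sigma E_i)\log\operatorname{tr}(\sigma E_i)+\sum_k\lambda_k\operatorname{tr}(\sigma_kE_i)\log\operatorname{tr}(\sigma_kE_i)\Big].$$ -/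

import Mathlib

open scoped ENNReal InnerProductSpace ComplexOrder

noncomputable section

namespace QuantumInfo

section Trace

variable {H : Type*} [NormedAddCommGroup H] [InnerProductSpace ℂ H] [CompleteSpace H]

/-- Index set of the fixed Hilbert basis of `H`. -/
def basisIndex (H : Type*) [NormedAddCommGroup H] [InnerProductSpace ℂ H] [CompleteSpace H] :
    Set H :=
  (exists_hilbertBasis ℂ H).choose

/-- A fixed complete orthonormal system of `H`, used to compute traces
(the trace of a positive or of a trace class operator does not depend on this choice). -/
def basis (H : Type*) [NormedAddCommGroup H] [InnerProductSpace ℂ H] [CompleteSpace H] :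
    HilbertBasis (basisIndex H) ℂ H :=
  (exists_hilbertBasis ℂ H).choose_spec.choose

/-- The trace, in `[0, ∞]`, of a positive bounded operator. -/
def posTrace (T : H →L[ℂ] H) : ℝ≥0∞ :=
  ∑' i, ENNReal.ofReal (⟪basis H i, T (basis H i)⟫_ℂ).re

/-- The trace of a trace class operator. -/
def trace (T : H →L[ℂ] H) : ℂ :=
  ∑' i, ⟪basis H i, T (basis H i)⟫_ℂ

end Trace

/-- Density operators (states) on the Hilbert space `H`: positive operators of trace one. -/
structure DensityOperator (H : Type*) [NormedAddCommGroup H] [InnerProductSpace ℂ H]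
    [CompleteSpace H] where
  op : H →L[ℂ] H
  isPositive : op.IsPositive
  posTrace_eq_one : posTrace op = 1

/-- A (discrete) projection valued measure: mutually orthogonal orthogonal projections
whose sum is the identity, in the strong operator topology. -/
structure ProjectionMeasure (ι : Type*) (H : Type*) [NormedAddCommGroup H]
    [InnerProductSpace ℂ H] [CompleteSpace H] where
  proj : ι → H →L[ℂ] H
  isStarProjection : ∀ i, IsStarProjection (proj i)
  orthogonal : ∀ i j, i ≠ j → proj i * proj j = 0
  hasSum : ∀ x : H, HasSum (fun i => proj i x) x

section TraceFacts

variable {H : Type*} [NormedAddCommGroup H] [InnerProductSpace ℂ H] [CompleteSpace H]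

theorem parseval (x : H) :
    ∑' i, ENNReal.ofReal (‖⟪basis H i, x⟫_ℂ‖ ^ 2) = ENNReal.ofReal (‖x‖ ^ 2) := by
  have h := (basis H).hasSum_inner_mul_inner x x
  have h1 : HasSum (fun i => ‖⟪basis H i, x⟫_ℂ‖ ^ 2) (‖x‖ ^ 2) := by
    have h2 := Complex.hasSum_re h
    convert h2 using 1
    · funext i
      rw [← inner_conj_symm x, ← Complex.normSq_eq_conj_mul_self, Complex.ofReal_re,
        Complex.normSq_eq_norm_sq]
    · rw [inner_self_eq_norm_sq_to_K]
      norm_cast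
  rw [← ENNReal.ofReal_tsum_of_nonneg (fun _ => by positivity) h1.summable, h1.tsum_eq]

theorem tsum_adjoint (A : H →L[ℂ] H) :
    ∑' i, ENNReal.ofReal (‖A (basis H i)‖ ^ 2) =
      ∑' i, ENNReal.ofReal (‖(star A) (basis H i)‖ ^ 2) := by
  calc ∑' i, ENNReal.ofReal (‖A (basis H i)‖ ^ 2)
      = ∑' i, ∑' j, ENNReal.ofReal (‖⟪basis H j, A (basis H i)⟫_ℂ‖ ^ 2) :=
        tsum_congr fun i => (parseval _).symm
    _ = ∑' j, ∑' i, ENNReal.ofReal (‖⟪basis H j, A (basis H i)⟫_ℂ‖ ^ 2) := ENNReal.tsum_comm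
    _ = ∑' j, ∑' i, ENNReal.ofReal (‖⟪basis H i, (star A) (basis H j)⟫_ℂ‖ ^ 2) := ?_
    _ = _ := tsum_congr fun j => parseval _
  refine tsum_congr fun j => tsum_congr fun i => ?_
  rw [ContinuousLinearMap.star_eq_adjoint, ContinuousLinearMap.adjoint_inner_right,
    ← inner_conj_symm, RCLike.norm_conj]

theorem exists_sqrt {T : H →L[ℂ] H} (hT : T.IsPositive) :
    ∃ R : H →L[ℂ] H, star R = R ∧ R * R = T := by
  have h0 : 0 ≤ T := (ContinuousLinearMap.nonneg_iff_isPositive T).2 hT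
  refine ⟨CFC.sqrt T, ?_, CFC.sqrt_mul_sqrt_self T h0⟩
  exact (IsSelfAdjoint.of_nonneg (CFC.sqrt_nonneg T)).star_eq

theorem inner_star_mul_self (A : H →L[ℂ] H) (x : H) :
    (⟪x, (star A * A) x⟫_ℂ).re = ‖A x‖ ^ 2 := by
  rw [mul_apply_eq_comp, ContinuousLinearMap.star_eq_adjoint,
    ContinuousLinearMap.adjoint_inner_right, inner_self_eq_norm_sq_to_K]
  norm_cast

theorem posTrace_star_mul_self (A : H →L[ℂ] H) :
    posTrace (star A * A) = ∑' i, ENNReal.ofReal (‖A (basis H i)‖ ^ 2) := by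
  simp only [posTrace, inner_star_mul_self]

theorem norm_le_posTrace {T : H →L[ℂ] H} (hT : T.IsPositive) :
    ENNReal.ofReal ‖T‖ ≤ posTrace T := by
  obtain ⟨R, hR, rfl⟩ := exists_sqrt hT
  have key : ∀ x : H, ENNReal.ofReal (‖R x‖ ^ 2) ≤
      posTrace (R * R) * ENNReal.ofReal (‖x‖ ^ 2) := by
    intro x
    rw [← parseval (R x)]
    nth_rewrite 2 [← hR]
    rw [posTrace_star_mul_self, ← ENNReal.tsum_mul_right]
    refine ENNReal.tsum_le_tsum fun i => ?_
    rw [← ENNReal.ofReal_mul (by positivity)]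
    refine ENNReal.ofReal_le_ofReal ?_
    rw [← mul_pow]
    gcongr
    have h : ⟪basis H i, R x⟫_ℂ = ⟪R (basis H i), x⟫_ℂ := by
      nth_rewrite 1 [← hR]
      rw [ContinuousLinearMap.star_eq_adjoint, ContinuousLinearMap.adjoint_inner_right]
    rw [h]
    exact norm_inner_le_norm _ _
  rcases eq_or_ne (posTrace (R * R)) ⊤ with h | h
  · rw [h]; exact le_top
  · rw [ENNReal.ofReal_le_iff_le_toReal h]
    have hn : ‖R * R‖ = ‖R‖ * ‖R‖ := by
      nth_rewrite 1 [← hR]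
      exact CStarRing.norm_star_mul_self
    rw [hn, ← sq]
    have hb : ‖R‖ ≤ Real.sqrt (posTrace (R * R)).toReal := by
      refine ContinuousLinearMap.opNorm_le_bound _ (Real.sqrt_nonneg _) fun x => ?_
      have hx := key x
      rw [← ENNReal.ofReal_toReal h, ← ENNReal.ofReal_mul ENNReal.toReal_nonneg,
        ENNReal.ofReal_le_ofReal_iff (by positivity)] at hx
      refine abs_le_of_sq_le_sq' ?_ (by positivity) |>.2
      rw [mul_pow, Real.sq_sqrt ENNReal.toReal_nonneg]
      exact hx
    calc ‖R‖ ^ 2 ≤ (Real.sqrt (posTrace (R * R)).toReal) ^ 2 := by gcongr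
      _ = _ := Real.sq_sqrt ENNReal.toReal_nonneg

theorem summable_of_tsum_posTrace {κ : Type*} {T : κ → H →L[ℂ] H}
    (hT : ∀ k, (T k).IsPositive) (h1 : ∑' k, posTrace (T k) = 1) : Summable T := by
  refine Summable.of_norm ?_
  have h2 : ∑' k, ENNReal.ofReal ‖T k‖ ≠ ⊤ := by
    refine ne_top_of_le_ne_top ENNReal.one_ne_top ?_
    rw [← h1]
    exact ENNReal.tsum_le_tsum fun k => norm_le_posTrace (hT k)
  simpa [ENNReal.toReal_ofReal] using ENNReal.summable_toReal h2

/-- The sum of a family of positive operators whose traces add up to one. The series converges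
absolutely in operator norm. -/
def DensityOperator.ofSum {κ : Type*} (T : κ → H →L[ℂ] H)
    (hT : ∀ k, (T k).IsPositive) (h1 : ∑' k, posTrace (T k) = 1) : DensityOperator H where
  op := ∑' k, T k
  isPositive := by
    rw [← ContinuousLinearMap.nonneg_iff_isPositive]
    exact tsum_nonneg fun k => (ContinuousLinearMap.nonneg_iff_isPositive _).2 (hT k)
  posTrace_eq_one := by
    have hs := (summable_of_tsum_posTrace hT h1).hasSum
    rw [← h1]
    simp only [posTrace]
    rw [ENNReal.tsum_comm]
    refine tsum_congr fun i => ?_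
    have h2 : HasSum (fun k => (⟪basis H i, T k (basis H i)⟫_ℂ).re)
        (⟪basis H i, (∑' k, T k) (basis H i)⟫_ℂ).re := by
      have h3 := hs.mapL (ContinuousLinearMap.apply ℂ H (basis H i))
      have h4 := h3.mapL (innerSL ℂ (basis H i))
      exact Complex.hasSum_re h4
    rw [← h2.tsum_eq, ENNReal.ofReal_tsum_of_nonneg _ h2.summable]
    exact fun k => (hT k).re_inner_nonneg_right _

theorem posTrace_smul {r : ℝ} (hr : 0 ≤ r) (T : H →L[ℂ] H) :
    posTrace ((r : ℂ) • T) = ENNReal.ofReal r * posTrace T := by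
  simp only [posTrace, ← ENNReal.tsum_mul_left]
  refine tsum_congr fun i => ?_
  rw [← ENNReal.ofReal_mul hr]
  simp

theorem ProjectionMeasure.tsum_norm_sq {ι : Type*} (E : ProjectionMeasure ι H) (x : H) :
    ∑' i, ENNReal.ofReal (‖E.proj i x‖ ^ 2) = ENNReal.ofReal (‖x‖ ^ 2) := by
  have h1 : HasSum (fun i => ‖E.proj i x‖ ^ 2) (‖x‖ ^ 2) := by
    have h := Complex.hasSum_re ((E.hasSum x).mapL (innerSL ℂ x))
    convert h using 1
    · funext i
      rw [← inner_star_mul_self, (E.isStarProjection i).isSelfAdjoint.star_eq,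
        (E.isStarProjection i).isIdempotentElem.eq]
      rfl
    · simp only [innerSL_apply_apply]
      rw [inner_self_eq_norm_sq_to_K]
      norm_cast
  rw [← ENNReal.ofReal_tsum_of_nonneg (fun _ => by positivity) h1.summable, h1.tsum_eq]

theorem ProjectionMeasure.isPositive_block {ι : Type*} (E : ProjectionMeasure ι H)
    (τ : DensityOperator H) (i : ι) : (E.proj i * τ.op * E.proj i).IsPositive := by
  have h := τ.isPositive.conj_adjoint (E.proj i)
  rw [← ContinuousLinearMap.star_eq_adjoint,
    (E.isStarProjection i).isSelfAdjoint.star_eq] at h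
  exact h

theorem ProjectionMeasure.tsum_posTrace_block {ι : Type*} (E : ProjectionMeasure ι H)
    (τ : DensityOperator H) : ∑' i, posTrace (E.proj i * τ.op * E.proj i) = 1 := by
  obtain ⟨R, hR, hRR⟩ := exists_sqrt τ.isPositive
  have hE : ∀ i, star (E.proj i) = E.proj i := fun i =>
    (E.isStarProjection i).isSelfAdjoint.star_eq
  have h1 : ∀ i, posTrace (E.proj i * τ.op * E.proj i) =
      ∑' j, ENNReal.ofReal (‖E.proj i (R (basis H j))‖ ^ 2) := by
    intro i
    have h2 : E.proj i * τ.op * E.proj i = star (R * E.proj i) * (R * E.proj i) := by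
      rw [star_mul, hR, hE, ← hRR]
      simp only [mul_assoc]
    rw [h2, posTrace_star_mul_self, tsum_adjoint, star_mul, hR, hE]
    rfl
  simp_rw [h1]
  rw [ENNReal.tsum_comm]
  simp_rw [E.tsum_norm_sq]
  rw [← posTrace_star_mul_self, hR, hRR, τ.posTrace_eq_one]

end TraceFacts

section Channels

variable {H H' : Type*} [NormedAddCommGroup H] [InnerProductSpace ℂ H] [CompleteSpace H]
  [NormedAddCommGroup H'] [InnerProductSpace ℂ H'] [CompleteSpace H']

/-- `Φ : B(H') → B(H)` is the dual map of the state map `Λ : S(H) → S(H')`. -/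
def IsDualMap (Λ : DensityOperator H → DensityOperator H')
    (Φ : (H' →L[ℂ] H') →ₗ[ℂ] (H →L[ℂ] H)) : Prop :=
  ∀ (ρ : DensityOperator H) (B : H' →L[ℂ] H'), trace ((Λ ρ).op * B) = trace (ρ.op * Φ B)

/-- A map `S(H) → S(H')` is a completely positive channel if it has a dual map `Φ` and
`∑ₖⱼ Aₖ* Φ(Bₖ* Bⱼ) Aⱼ ≥ 0` for all finite families in `B(H)` and `B(H')`. -/
def IsCompletelyPositiveChannel (Λ : DensityOperator H → DensityOperator H') : Prop :=
  ∃ Φ : (H' →L[ℂ] H') →ₗ[ℂ] (H →L[ℂ] H), IsDualMap Λ Φ ∧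
    ∀ (n : ℕ) (A : Fin n → H →L[ℂ] H) (B : Fin n → H' →L[ℂ] H'),
      (∑ k, ∑ j, star (A k) * Φ (star (B k) * B j) * A j).IsPositive

/-- The pinching `τ ↦ ∑ᵢ Eᵢ τ Eᵢ`. -/
def pinching {ι : Type*} (E : ProjectionMeasure ι H) (τ : DensityOperator H) :
    DensityOperator H :=
  DensityOperator.ofSum (fun i => E.proj i * τ.op * E.proj i) (E.isPositive_block τ)
    (E.tsum_posTrace_block τ)

/-- The classical-quantum channel of a quantum coding `k ↦ σₖ`: it sends the probability
distribution `{λₖ}` to the coded state `∑ₖ λₖ σₖ`. -/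
def codingChannel {κ : Type*} (σ : κ → DensityOperator H) (p : PMF κ) : DensityOperator H :=
  DensityOperator.ofSum (fun k => ((p k).toReal : ℂ) • (σ k).op)
    (fun k => by
      have h : (0 : ℂ) ≤ ((p k).toReal : ℂ) := by
        exact_mod_cast ENNReal.toReal_nonneg
      exact (σ k).isPositive.smul_of_nonneg h)
    (by
      simp_rw [posTrace_smul ENNReal.toReal_nonneg, (σ _).posTrace_eq_one, mul_one,
        ENNReal.ofReal_toReal (p.apply_ne_top _)]
      exact p.tsum_coe)

/-- Orthogonal projection onto the eigenspace of `T` for the real number `a`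
(zero when `a` is not an eigenvalue). -/
def eigenProj (T : H →L[ℂ] H) (a : ℝ) : H →L[ℂ] H :=
  (LinearMap.ker (T - (a : ℂ) • (1 : H →L[ℂ] H)).toLinearMap).starProjection

/-- The von Neumann entropy `S(ρ) = - tr ρ log ρ`, computed from the spectral decomposition
`ρ = ∑ₐ a Pₐ`, as an element of `[0, ∞]`. -/
def vonNeumannEntropy (ρ : DensityOperator H) : ℝ≥0∞ :=
  ∑' a : ℝ, ENNReal.ofReal (Real.negMulLog a) * posTrace (eigenProj ρ.op a)

open Classical in
/-- The quantum relative entropy `S(ρ, σ)`, with values in `[0, ∞]`. If the closure of the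
range of `ρ` is contained in that of `σ`, it is `tr ρ (log ρ - log σ)`, otherwise it is `∞`.

In infinite dimension `log ρ` and `log σ` are unbounded and the trace is read, as usual, through
the spectral decompositions `ρ = ∑ₐ a Pₐ` and `σ = ∑_b b Q_b`, as
`∑ₐ ∑_b tr (Pₐ Q_b) (a log a - a log b + b - a)`. Here `∑ₐ ∑_b tr (Pₐ Q_b) (b - a) = 0` because
both traces are one; adding this term makes every summand nonnegative, so that the
double series has a value in `[0, ∞]`. Also `tr (Pₐ Q_b) = tr (Pₐ Q_b Pₐ)`. -/
def relativeEntropy (ρ σ : DensityOperator H) : ℝ≥0∞ :=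
  if closure (Set.range ρ.op) ⊆ closure (Set.range σ.op) then
    ∑' (a : ℝ) (b : ℝ),
      posTrace (eigenProj ρ.op a * eigenProj σ.op b * eigenProj ρ.op a) *
        ENNReal.ofReal (a * (Real.log a - Real.log b) + b - a)
  else ⊤

/-- A Schatten decomposition of a classical state: a decomposition
into distinct (hence mutually orthogonal) pure states, that is, point masses. -/
structure ClassicalSchattenDecomposition {κ : Type*} (p : PMF κ) where
  states : Set (PMF κ)
  isPure : ∀ e ∈ states, ∃ k, e = PMF.pure k
  weight : states → ℝ≥0∞
  eq_sum : ∀ x, p x = ∑' e : states, weight e * e.1 x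

/-- The mutual entropy `I(p; Λ)` of a classical input state `p` and a channel `Λ` into a quantum
system: the supremum of `∑ₑ wₑ S(Λ e, Λ p)` over all Schatten decompositions `p = ∑ₑ wₑ e`. -/
def mutualEntropy {κ : Type*} (p : PMF κ) (Λ : PMF κ → DensityOperator H) : ℝ≥0∞ :=
  ⨆ D : ClassicalSchattenDecomposition p,
    ∑' e : D.states, D.weight e * relativeEntropy (Λ e.1) (Λ p)

/-- `tr (τ Eᵢ)`, the probability of the outcome `i` in the state `τ`. -/
def outcomeProb {ι : Type*} (E : ProjectionMeasure ι H) (τ : DensityOperator H) (i : ι) : ℝ :=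
  (trace (τ.op * E.proj i)).re

end Channels

end QuantumInfo

end

namespace QuantumInfo

/-! Everything rests on monotonicity of the relative entropy, proved here without operator
logarithms. For `b > 0`, `a log a - a log b + b - a` is the integral over `s > 0` of `s (a - b)² /
((1 + s)² (a + s b))`, and this integrand plus the parallel sum `a b / (a + s b)` is linear in `a`
and `b`. Averaged against `tr (Pₐ Q_b)`, the linear part depends on `s` alone, because both states
have trace one. So the relative entropy decreases as soon as, for each `s`, the averaged parallel
sum increases (`tsum_scalarEntropy_le`).

The averaged parallel sum is the infimum over bounded `A` of `s⁻¹ tr A τ A* + tr (1 - A)* σ (1 -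
A)`. The upper bound by each `A` is `tsum_parallel_le_weight`; near-minimisers are finite
combinations of the `Q_b Pₐ` (`exists_finset_parallel_le`, `ProjectionMeasure.multiplier`).
Monotonicity thus only requires carrying a trial operator `B` on the output side back to one on the
input side at no greater cost, up to `ε`. For a completely positive channel `Φ B` works, by the
Schwarz inequality; for a pinching, a finite part of `∑ Eᵢ B Eᵢ`; for passing from pinched states to
outcome distributions, `∑ cᵢ Eᵢ`.

The rest is bookkeeping in `[0, ∞]`. The mutual entropy has the same value on every Schatten
decomposition. The bracket for the outcome `i` is the average over `k` of classical relative entropy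
terms. The Holevo identity holds because `S(τ, σ) + S(τ) = - tr τ log σ` is affine in `τ`. -/

theorem ker_sub_smul_one {H : Type*} [NormedAddCommGroup H] [InnerProductSpace ℂ H]
    (T : H →L[ℂ] H) (a : ℝ) :
    LinearMap.ker (T - (a : ℂ) • (1 : H →L[ℂ] H)).toLinearMap =
      Module.End.eigenspace (T : Module.End ℂ H) (a : ℂ) := by
  ext x
  simp [sub_eq_zero]

/-! ### Hilbert-Schmidt norms with values in `[0, ∞]` -/

section HilbertSchmidt

variable {H : Type*} [NormedAddCommGroup H] [InnerProductSpace ℂ H] [CompleteSpace H]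

/-- The square of the Hilbert-Schmidt norm, with values in `[0, ∞]`. -/
noncomputable def hs (A : H →L[ℂ] H) : ℝ≥0∞ :=
  ∑' i, ENNReal.ofReal (‖A (basis H i)‖ ^ 2)

theorem hs_star (A : H →L[ℂ] H) : hs (star A) = hs A := (tsum_adjoint A).symm

theorem hs_zero : hs (0 : H →L[ℂ] H) = 0 := by simp [hs]

theorem hs_smul (c : ℝ) (A : H →L[ℂ] H) :
    hs ((c : ℂ) • A) = ENNReal.ofReal (c ^ 2) * hs A := by
  simp only [hs, ← ENNReal.tsum_mul_left]
  refine tsum_congr fun i => ?_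
  rw [← ENNReal.ofReal_mul (sq_nonneg c)]
  congr 1
  simp [norm_smul, mul_pow]

theorem enorm_sq_le_hs (A : H →L[ℂ] H) : ENNReal.ofReal (‖A‖ ^ 2) ≤ hs A := by
  have h := norm_le_posTrace (T := star A * A)
    (by
      rw [ContinuousLinearMap.star_eq_adjoint]
      exact ContinuousLinearMap.isPositive_adjoint_comp_self A)
  rw [posTrace_star_mul_self, CStarRing.norm_star_mul_self, ← sq] at h
  exact h

theorem hs_eq_zero {A : H →L[ℂ] H} : hs A = 0 ↔ A = 0 := by
  refine ⟨fun h => ?_, fun h => by rw [h, hs_zero]⟩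
  have h1 := enorm_sq_le_hs A
  rw [h, nonpos_iff_eq_zero, ENNReal.ofReal_eq_zero] at h1
  exact norm_eq_zero.1 (pow_eq_zero_iff two_ne_zero |>.1 (le_antisymm h1 (sq_nonneg _)))

theorem ProjectionMeasure.star_proj {ι : Type*} (E : ProjectionMeasure ι H) (i : ι) :
    star (E.proj i) = E.proj i := (E.isStarProjection i).isSelfAdjoint.star_eq

theorem ProjectionMeasure.proj_mul_self {ι : Type*} (E : ProjectionMeasure ι H) (i : ι) :
    E.proj i * E.proj i = E.proj i := (E.isStarProjection i).isIdempotentElem.eq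

theorem ProjectionMeasure.tsum_hs_proj_mul {ι : Type*} (E : ProjectionMeasure ι H)
    (A : H →L[ℂ] H) : ∑' i, hs (E.proj i * A) = hs A := by
  simp only [hs]
  rw [ENNReal.tsum_comm]
  exact tsum_congr fun j => E.tsum_norm_sq _

theorem ProjectionMeasure.tsum_hs_mul_proj {ι : Type*} (E : ProjectionMeasure ι H)
    (A : H →L[ℂ] H) : ∑' i, hs (A * E.proj i) = hs A := by
  rw [← hs_star A, ← E.tsum_hs_proj_mul (star A)]
  refine tsum_congr fun i => ?_
  rw [← hs_star, star_mul, E.star_proj]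

/-- The parallel sum `s t / (s + t)` is the best constant in `s x² + t y² ≥ C (x + y)²`; the defect
is a multiple of `(s x - t y)²`. Applied to each basis vector. -/
theorem hs_parallelogram (A B : H →L[ℂ] H) (s t : ℝ) (hs' : 0 < s) (ht : 0 < t) :
    ENNReal.ofReal (s * t / (s + t)) * hs (A + B) ≤
      ENNReal.ofReal s * hs A + ENNReal.ofReal t * hs B := by
  simp only [hs, ← ENNReal.tsum_mul_left]
  rw [← ENNReal.tsum_add]
  refine ENNReal.tsum_le_tsum fun i => ?_
  rw [← ENNReal.ofReal_mul (by positivity), ← ENNReal.ofReal_mul (by positivity),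
    ← ENNReal.ofReal_mul (by positivity), ← ENNReal.ofReal_add (by positivity) (by positivity)]
  refine ENNReal.ofReal_le_ofReal ?_
  set x := ‖A (basis H i)‖
  set y := ‖B (basis H i)‖
  have h : ‖(A + B) (basis H i)‖ ≤ x + y := norm_add_le _ _
  calc s * t / (s + t) * ‖(A + B) (basis H i)‖ ^ 2 ≤ s * t / (s + t) * (x + y) ^ 2 := by gcongr
    _ ≤ s * x ^ 2 + t * y ^ 2 := by
        rw [div_mul_eq_mul_div, div_le_iff₀ (by positivity)]
        nlinarith [sq_nonneg (s * x - t * y)]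

end HilbertSchmidt

/-! ### Spectral decomposition of a state -/

section Spectral

variable {H : Type*} [NormedAddCommGroup H] [InnerProductSpace ℂ H] [CompleteSpace H]

theorem DensityOperator.ext' {ρ σ : DensityOperator H} (h : ρ.op = σ.op) : ρ = σ := by
  cases ρ; cases σ; congr

-- With `R` the square root, the state is `∑ |R eᵢ⟩⟨R eᵢ|`. The norms `‖R eᵢ‖²` add up to the trace,
-- so the series converges in operator norm and its sum is a norm limit of finite rank operators.
open InnerProductSpace in
theorem DensityOperator.isCompactOperator (τ : DensityOperator H) : IsCompactOperator τ.op := by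
  obtain ⟨R, hR, hRR⟩ := exists_sqrt τ.isPositive
  have hsum : Summable fun i => rankOne ℂ (R (basis H i)) (R (basis H i)) := by
    refine Summable.of_norm ?_
    have h2 : ∑' i, ENNReal.ofReal (‖R (basis H i)‖ ^ 2) ≠ ⊤ := by
      rw [← posTrace_star_mul_self, hR, hRR, τ.posTrace_eq_one]
      exact ENNReal.one_ne_top
    have h3 := ENNReal.summable_toReal h2
    refine h3.congr fun i => ?_
    rw [norm_rankOne, ENNReal.toReal_ofReal (by positivity), sq]
  have heq : ∑' i, rankOne ℂ (R (basis H i)) (R (basis H i)) = τ.op := by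
    ext x
    have h1 := hsum.hasSum.mapL (ContinuousLinearMap.apply ℂ H x)
    have h2 := ((basis H).hasSum_repr (R x)).mapL R
    have h3 : R (R x) = τ.op x := by rw [← hRR]; rfl
    rw [h3] at h2
    refine h1.unique ?_
    convert h2 using 1
    funext i
    simp only [ContinuousLinearMap.apply_apply, rankOne_apply, map_smul, HilbertBasis.repr_apply_apply]
    congr 1
    conv_lhs => rw [← hR]
    rw [ContinuousLinearMap.star_eq_adjoint, ContinuousLinearMap.adjoint_inner_left]
  rw [← heq]
  refine isCompactOperator_of_tendsto (l := Filter.atTop)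
    (by simpa [HasSum] using hsum.hasSum) ?_
  refine Filter.Eventually.of_forall fun s => ?_
  change (∑ i ∈ s, rankOne ℂ (R (basis H i)) (R (basis H i))) ∈ compactOperator (RingHom.id ℂ) H H
  refine Submodule.sum_mem _ fun i _ => ?_
  change IsCompactOperator (rankOne ℂ (R (basis H i)) (R (basis H i)))
  rw [rankOne_def']
  exact (isCompactOperator_of_locallyCompactSpace_rng
    (ContinuousLinearMap.toSpanSingleton ℂ (R (basis H i)))).comp_clm _

theorem DensityOperator.isSymmetric (τ : DensityOperator H) :
    (τ.op : H →ₗ[ℂ] H).IsSymmetric := τ.isPositive.isSymmetric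

theorem isStarProjection_eigenProj (T : H →L[ℂ] H) (a : ℝ) : IsStarProjection (eigenProj T a) :=
  isStarProjection_starProjection

theorem mul_eigenProj (T : H →L[ℂ] H) (a : ℝ) : T * eigenProj T a = (a : ℂ) • eigenProj T a := by
  ext x
  have h : eigenProj T a x ∈ LinearMap.ker (T - (a : ℂ) • (1 : H →L[ℂ] H)).toLinearMap :=
    Submodule.starProjection_apply_mem _ _
  simpa [sub_eq_zero] using h

theorem eigenProj_apply_of_eq {T : H →L[ℂ] H} {a : ℝ} {x : H} (h : T x = (a : ℂ) • x) :
    eigenProj T a x = x := by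
  refine Submodule.starProjection_eq_self_iff.2 ?_
  simp [h]

theorem DensityOperator.eigenProj_mul (τ : DensityOperator H) (a : ℝ) :
    eigenProj τ.op a * τ.op = (a : ℂ) • eigenProj τ.op a := by
  have h := congrArg star (mul_eigenProj τ.op a)
  rw [star_mul, star_smul, (isStarProjection_eigenProj τ.op a).isSelfAdjoint.star_eq,
    τ.isPositive.isSelfAdjoint.star_eq] at h
  simpa using h

theorem DensityOperator.eigenProj_mul_eigenProj (τ : DensityOperator H) {a b : ℝ} (hab : a ≠ b) :
    eigenProj τ.op a * eigenProj τ.op b = 0 := by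
  have h1 : (a : ℂ) • (eigenProj τ.op a * eigenProj τ.op b) =
      (b : ℂ) • (eigenProj τ.op a * eigenProj τ.op b) := by
    rw [← smul_mul_assoc, ← τ.eigenProj_mul, mul_assoc, mul_eigenProj, mul_smul_comm]
  rw [← sub_eq_zero, ← sub_smul, smul_eq_zero, sub_eq_zero] at h1
  exact h1.resolve_left (by exact_mod_cast hab)

/-- The eigenspaces of a compact self-adjoint operator are orthogonal and total. All eigenvalues are
real, so indexing by `ℝ` loses none. -/
theorem DensityOperator.hasSum_eigenProj (τ : DensityOperator H) (x : H) :
    HasSum (fun a : ℝ => eigenProj τ.op a x) x := by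
  let V : ℝ → Submodule ℂ H := fun a => Module.End.eigenspace (τ.op : Module.End ℂ H) (a : ℂ)
  have hclosed : ∀ a, IsClosed (V a : Set H) := fun a => by
    rw [show V a = _ from (ker_sub_smul_one τ.op a).symm]
    exact ContinuousLinearMap.isClosed_ker _
  have : ∀ a, CompleteSpace (V a) := fun a => (hclosed a).completeSpace_coe
  have hV : OrthogonalFamily ℂ (fun a => V a) fun a => (V a).subtypeₗᵢ :=
    τ.isSymmetric.orthogonalFamily_eigenspaces.comp Complex.ofReal_injective
  have htot : ⊤ ≤ (⨆ a, V a).topologicalClosure := by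
    rw [← Submodule.orthogonal_orthogonal_eq_closure]
    have h1 : (⨆ a, V a)ᗮ = ⊥ := by
      rw [eq_bot_iff, ← ContinuousLinearMap.orthogonalComplement_iSup_eigenspaces_eq_bot
        τ.isCompactOperator τ.isSymmetric]
      refine Submodule.orthogonal_le (iSup_le fun μ => ?_)
      by_cases h : Module.End.HasEigenvalue (τ.op : Module.End ℂ H) μ
      · have h2 := τ.isSymmetric.conj_eigenvalue_eq_self h
        obtain ⟨r, rfl⟩ := Complex.conj_eq_iff_real.1 h2
        exact le_iSup V r
      · rw [Module.End.hasEigenvalue_iff, not_not] at h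
        rw [h]; exact bot_le
    rw [h1, Submodule.bot_orthogonal_eq_top]
  have hH := IsHilbertSum.mkInternal V hV htot
  have h3 := hH.hasSum_linearIsometryEquiv_symm (hH.linearIsometryEquiv x)
  rw [LinearIsometryEquiv.symm_apply_apply] at h3
  set w := hH.linearIsometryEquiv x
  have hmem : ∀ a : ℝ, eigenProj τ.op a (w a) = w a := fun a =>
    eigenProj_apply_of_eq (Module.End.mem_eigenspace_iff.1 (w a).2)
  -- Applying one spectral projection to the orthogonal expansion of `x` isolates the corresponding
  -- component.
  have h4 : ∀ a : ℝ, eigenProj τ.op a x = w a := by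
    intro a
    have h5 := h3.mapL (eigenProj τ.op a)
    refine h5.unique ?_
    convert hasSum_single a ?_ using 1
    · exact (hmem a).symm
    · intro b hb
      change eigenProj τ.op a (w b) = 0
      rw [← hmem b, ← mul_apply_eq_comp, τ.eigenProj_mul_eigenProj hb.symm]
      rfl
  simp only [h4]
  exact h3

/-- The spectral measure of a state. -/
noncomputable def DensityOperator.spectralMeasure (τ : DensityOperator H) :
    ProjectionMeasure ℝ H where
  proj := eigenProj τ.op
  isStarProjection := isStarProjection_eigenProj τ.op
  orthogonal _ _ h := τ.eigenProj_mul_eigenProj h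
  hasSum := τ.hasSum_eigenProj

theorem DensityOperator.eigenProj_of_neg (τ : DensityOperator H) {a : ℝ} (ha : a < 0) :
    eigenProj τ.op a = 0 := by
  by_contra h
  obtain ⟨x, hx⟩ : ∃ x, eigenProj τ.op a x ≠ 0 := by
    by_contra h'
    push Not at h'
    exact h (ContinuousLinearMap.ext h')
  set y := eigenProj τ.op a x
  have hy : τ.op y = (a : ℂ) • y := by
    have := congrArg (fun T : H →L[ℂ] H => T x) (mul_eigenProj τ.op a)
    simpa using this
  have h1 := τ.isPositive.re_inner_nonneg_right y
  rw [hy, inner_smul_right, inner_self_eq_norm_sq_to_K] at h1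
  have h2 : (0:ℝ) ≤ a * ‖y‖ ^ 2 := by
    have h3 : RCLike.re ((a : ℂ) * ((‖y‖ : ℝ) : ℂ) ^ 2) = a * ‖y‖ ^ 2 := by
      norm_cast
    rw [← h3]; exact h1
  have : 0 < ‖y‖ ^ 2 := by positivity
  nlinarith

theorem DensityOperator.hasSum_inner (τ : DensityOperator H) (x : H) :
    HasSum (fun a : ℝ => a * ‖eigenProj τ.op a x‖ ^ 2) (⟪x, τ.op x⟫_ℂ).re := by
  have h := Complex.hasSum_re (((τ.hasSum_eigenProj x).mapL τ.op).mapL (innerSL ℂ x))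
  rw [innerSL_apply_apply] at h
  convert h using 1
  funext a
  have h1 : τ.op (eigenProj τ.op a x) = (a : ℂ) • eigenProj τ.op a x := by
    have := congrArg (fun T : H →L[ℂ] H => T x) (mul_eigenProj τ.op a)
    simpa using this
  have hP := isStarProjection_eigenProj τ.op a
  rw [h1, map_smul, innerSL_apply_apply, ← inner_star_mul_self, hP.isSelfAdjoint.star_eq,
    hP.isIdempotentElem.eq]
  simp

/-- `tr A τ A*`. -/
noncomputable def DensityOperator.weight (τ : DensityOperator H) (A : H →L[ℂ] H) : ℝ≥0∞ :=
  posTrace (A * τ.op * star A)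

theorem inner_conj_star (A T : H →L[ℂ] H) (x : H) :
    ⟪x, (A * T * star A) x⟫_ℂ = ⟪star A x, T (star A x)⟫_ℂ := by
  rw [mul_apply_eq_comp, mul_apply_eq_comp, ContinuousLinearMap.star_eq_adjoint,
    ContinuousLinearMap.adjoint_inner_left]

theorem DensityOperator.weight_eq_tsum (τ : DensityOperator H) (A : H →L[ℂ] H) :
    τ.weight A = ∑' a : ℝ, ENNReal.ofReal a * hs (A * eigenProj τ.op a) := by
  have h1 : ∀ a : ℝ, ENNReal.ofReal a * hs (A * eigenProj τ.op a) =
      ∑' i, ENNReal.ofReal (a * ‖eigenProj τ.op a (star A (basis H i))‖ ^ 2) := by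
    intro a
    rw [← hs_star, star_mul, (isStarProjection_eigenProj τ.op a).isSelfAdjoint.star_eq, hs,
      ← ENNReal.tsum_mul_left]
    refine tsum_congr fun i => ?_
    rw [ENNReal.ofReal_mul' (by positivity)]
    rfl
  simp_rw [h1]
  rw [ENNReal.tsum_comm, weight, posTrace]
  refine tsum_congr fun i => ?_
  have h2 := τ.hasSum_inner (star A (basis H i))
  rw [inner_conj_star, ← h2.tsum_eq, ENNReal.ofReal_tsum_of_nonneg _ h2.summable]
  -- `ENNReal.ofReal` truncates negative `a`; this is harmless because the projection is zero there.
  intro a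
  rcases le_or_gt 0 a with ha | ha
  · positivity
  · simp [τ.eigenProj_of_neg ha]

theorem DensityOperator.weight_one (τ : DensityOperator H) : τ.weight 1 = 1 := by
  simp [weight, τ.posTrace_eq_one]

theorem DensityOperator.weight_eq_tsum_tsum {ι : Type*} (τ : DensityOperator H)
    (E : ProjectionMeasure ι H) (A : H →L[ℂ] H) :
    τ.weight A = ∑' (a : ℝ) (i : ι), ENNReal.ofReal a * hs (E.proj i * A * eigenProj τ.op a) := by
  rw [weight_eq_tsum]
  refine tsum_congr fun a => ?_
  rw [ENNReal.tsum_mul_left, ← E.tsum_hs_proj_mul (A * _)]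
  simp only [mul_assoc]

/-- A nonzero projection has norm one, hence trace at least one, so an eigenvalue above `1` would
alone exceed the total trace. -/
theorem DensityOperator.eigenProj_of_one_lt (τ : DensityOperator H) {a : ℝ} (ha : 1 < a) :
    eigenProj τ.op a = 0 := by
  by_contra hne
  have h0 : 1 ≤ hs (eigenProj τ.op a) := by
    refine le_trans ?_ (enorm_sq_le_hs _)
    have h3 : ‖eigenProj τ.op a‖ = 1 := by
      have hP := isStarProjection_eigenProj τ.op a
      have h4 := CStarRing.norm_star_mul_self (x := eigenProj τ.op a)
      rw [hP.isSelfAdjoint.star_eq, hP.isIdempotentElem.eq] at h4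
      have h5 : ‖eigenProj τ.op a‖ ≠ 0 := norm_ne_zero_iff.2 hne
      exact mul_right_cancel₀ h5 (by rw [one_mul]; exact h4.symm)
    simp [h3]
  have h1 := τ.weight_eq_tsum 1
  rw [τ.weight_one] at h1
  have h2 := ENNReal.le_tsum (f := fun a : ℝ => ENNReal.ofReal a * hs (1 * eigenProj τ.op a)) a
  rw [← h1, one_mul] at h2
  have h3 : 1 < ENNReal.ofReal a := by
    rw [← ENNReal.ofReal_one]; exact (ENNReal.ofReal_lt_ofReal_iff (by linarith)).2 ha
  exact absurd (le_trans (le_mul_of_one_le_right zero_le h0) h2) (not_le.2 h3)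

end Spectral

/-! ### Integral representation of the scalar entropy -/

section Scalar

open MeasureTheory Set Filter Topology

/-- The integrand of the integral representation of `a log a - a log b + b - a`. -/
noncomputable def entropyIntegrand (s a b : ℝ) : ℝ :=
  s * (a - b) ^ 2 / ((1 + s) ^ 2 * (a + s * b))

theorem entropyIntegrand_nonneg {s a b : ℝ} (hs : 0 ≤ s) (ha : 0 ≤ a) (hb : 0 ≤ b) :
    0 ≤ entropyIntegrand s a b := by
  unfold entropyIntegrand; positivity

theorem measurable_entropyIntegrand (a b : ℝ) :
    Measurable fun s => ENNReal.ofReal (entropyIntegrand s a b) := by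
  unfold entropyIntegrand; fun_prop

/-- The right side is linear in `(a, b)`, so its average is fixed by the normalisation: lowering the
entropy integrand is the same as raising the parallel sum. -/
theorem entropyIntegrand_add {s a b : ℝ} (hs : 0 < s) (ha : 0 ≤ a) (hb : 0 ≤ b) :
    entropyIntegrand s a b + a * b / (a + s * b) = (s * a + b) / (1 + s) ^ 2 := by
  -- A zero denominator forces `a = b = 0`, where division by zero gives the correct value `0`.
  rcases eq_or_lt_of_le (by positivity : 0 ≤ a + s * b) with h | h
  · have h1 : a = 0 := by nlinarith [mul_nonneg hs.le hb]
    have h2 : b = 0 := by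
      subst h1; rcases mul_eq_zero.1 (by linarith : s * b = 0) with h | h
      · exact absurd h hs.ne'
      · exact h
    subst h1 h2
    simp [entropyIntegrand]
  · unfold entropyIntegrand
    have : 1 + s ≠ 0 := by positivity
    field_simp
    ring

/-- `∫₀^∞ s (a - b)² / ((1 + s)² (a + s b)) ds`, which is `a log a - a log b + b - a`
for `b > 0`. -/
noncomputable def scalarEntropy (a b : ℝ) : ℝ≥0∞ :=
  ∫⁻ s in Ioi (0 : ℝ), ENNReal.ofReal (entropyIntegrand s a b)

theorem scalarEntropy_zero_zero : scalarEntropy 0 0 = 0 := by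
  simp [scalarEntropy, entropyIntegrand]

theorem scalarEntropy_of_primitive {a b l : ℝ} {f : ℝ → ℝ} (ha : 0 ≤ a) (hb : 0 ≤ b)
    (hcont : ContinuousWithinAt f (Ici 0) 0)
    (hf : ∀ s ∈ Ioi (0 : ℝ), HasDerivAt f (entropyIntegrand s a b) s)
    (hl : Tendsto f atTop (𝓝 l)) : scalarEntropy a b = ENNReal.ofReal (l - f 0) := by
  have hnn : ∀ s ∈ Ioi (0 : ℝ), 0 ≤ entropyIntegrand s a b := fun s hs =>
    entropyIntegrand_nonneg (mem_Ioi.1 hs).le ha hb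
  rw [← integral_Ioi_of_hasDerivAt_of_nonneg hcont hf hnn hl, scalarEntropy,
    ofReal_integral_eq_lintegral_ofReal (integrableOn_Ioi_deriv_of_nonneg hcont hf hnn hl)]
  exact (ae_restrict_iff' measurableSet_Ioi).2 (Eventually.of_forall hnn)

theorem hasDerivAt_inv_one_add {s : ℝ} (hs : 0 < s) :
    HasDerivAt (fun s : ℝ => (1 + s)⁻¹) (-(1 / (1 + s) ^ 2)) s := by
  have h := ((hasDerivAt_id s).const_add 1).inv (by simp; positivity)
  exact h.congr_deriv (by simp [neg_div])

theorem tendsto_inv_one_add : Tendsto (fun s : ℝ => (1 + s)⁻¹) atTop (𝓝 0) :=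
  tendsto_inv_atTop_zero.comp (tendsto_atTop_add_const_left _ _ tendsto_id)

theorem scalarEntropy_of_pos {a b : ℝ} (ha : 0 ≤ a) (hb : 0 < b) :
    scalarEntropy a b = ENNReal.ofReal (a * (Real.log a - Real.log b) + b - a) := by
  rcases eq_or_lt_of_le ha with rfl | ha
  -- For `a = 0` the integrand is `b / (1 + s)²` on `s > 0`. The case is separate because `log (a +
  -- s b)`, used in the general primitive, is singular at `s = 0`.
  · rw [scalarEntropy_of_primitive (f := fun s => -b * (1 + s)⁻¹) (l := -b * 0) le_rfl hb.le]
    · simp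
    · have : ContinuousAt (fun s : ℝ => -b * (1 + s)⁻¹) 0 := by
        refine ContinuousAt.mul continuousAt_const (ContinuousAt.inv₀ (by fun_prop) (by norm_num))
      exact this.continuousWithinAt
    · intro s hs
      have hs : 0 < s := hs
      refine ((hasDerivAt_inv_one_add hs).const_mul (-b)).congr_deriv ?_
      unfold entropyIntegrand
      have : 1 + s ≠ 0 := by positivity
      field_simp
      ring
    · exact tendsto_inv_one_add.const_mul _
  -- The primitive comes from partial fractions in `s`: the integrand is `a / (1 + s) - a b / (a + s
  -- b) + (b - a) / (1 + s)²`.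
  · have hder : ∀ s : ℝ, 0 ≤ s → HasDerivAt
        (fun s => a * (Real.log (1 + s) - Real.log (a + s * b)) - (b - a) * (1 + s)⁻¹)
        (entropyIntegrand s a b) s := by
      intro s hs
      have h1 : 0 < 1 + s := by positivity
      have h2 : 0 < a + s * b := by positivity
      have d1 := ((hasDerivAt_id s).const_add 1).log h1.ne'
      have d2 := (((hasDerivAt_id s).mul_const b).const_add a).log h2.ne'
      have d3 := ((hasDerivAt_id s).const_add 1).inv h1.ne'
      refine (((d1.sub d2).const_mul a).sub (d3.const_mul (b - a))).congr_deriv ?_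
      unfold entropyIntegrand
      simp only [id_eq]
      field_simp
      ring
    rw [scalarEntropy_of_primitive (l := a * (- Real.log b) - (b - a) * 0) ha.le hb.le
      (hder 0 le_rfl).continuousAt.continuousWithinAt (fun s hs => hder s (mem_Ioi.1 hs).le)]
    · congr 1
      simp
      ring
    · refine Tendsto.sub (Tendsto.const_mul _ ?_) (tendsto_inv_one_add.const_mul _)
      have h1 : Tendsto (fun s : ℝ => (a - b) * (1 + s)⁻¹ + b) atTop (𝓝 ((a - b) * 0 + b)) :=
        (tendsto_inv_one_add.const_mul _).add_const _
      rw [mul_zero, zero_add] at h1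
      refine ((h1.log hb.ne').neg).congr' ?_
      filter_upwards [eventually_gt_atTop 0] with s hs
      have h2 : 0 < 1 + s := by positivity
      have h3 : 0 < a + s * b := by positivity
      rw [← Real.log_div h2.ne' h3.ne', ← Real.log_inv]
      congr 1
      have : (a - b) * (1 + s)⁻¹ + b = (a + s * b) / (1 + s) := by field_simp; ring
      rw [this, inv_div]

/-- The integrand is `s a / (1 + s)²`, which is at least `a / (4 s)` for `s > 1`, so the integral
diverges like the harmonic one. This infinity encodes the support condition of the relative entropy.
-/
theorem scalarEntropy_zero_right {a : ℝ} (ha : 0 < a) : scalarEntropy a 0 = ⊤ := by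
  by_contra hne
  refine not_integrableOn_Ioi_inv (a := 1) ?_
  have hmeas : Measurable fun s : ℝ => s⁻¹ := by fun_prop
  refine ⟨hmeas.aestronglyMeasurable, ?_⟩
  rw [hasFiniteIntegral_iff_ofReal]
  · have h1 : ∫⁻ s in Ioi (1 : ℝ), ENNReal.ofReal s⁻¹ ≤
        ENNReal.ofReal (4 / a) * scalarEntropy a 0 := by
      rw [scalarEntropy, ← lintegral_const_mul _ (measurable_entropyIntegrand a 0)]
      refine le_trans ?_ (lintegral_mono_set (Ioi_subset_Ioi zero_le_one))
      refine setLIntegral_mono' measurableSet_Ioi fun s hs => ?_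
      have hs : 1 < s := hs
      rw [← ENNReal.ofReal_mul (by positivity)]
      refine ENNReal.ofReal_le_ofReal ?_
      unfold entropyIntegrand
      have h2 : 4 / a * (s * (a - 0) ^ 2 / ((1 + s) ^ 2 * (a + s * 0))) = 4 * s / (1 + s) ^ 2 := by
        have : 1 + s ≠ 0 := by positivity
        field_simp
        ring
      rw [h2, inv_eq_one_div, div_le_div_iff₀ (by positivity) (by positivity)]
      nlinarith
    exact h1.trans_lt (ENNReal.mul_lt_top ENNReal.ofReal_lt_top (lt_top_iff_ne_top.2 hne))
  · refine (ae_restrict_iff' measurableSet_Ioi).2 (Eventually.of_forall fun s hs => ?_)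
    exact inv_nonneg.2 (le_trans zero_le_one (mem_Ioi.1 hs).le)

/-- Only an inequality survives at `b = 0`, where the convention `Real.log 0 = 0` makes the left
side finite. -/
theorem ofReal_le_scalarEntropy {a b : ℝ} (ha : 0 ≤ a) (hb : 0 ≤ b) :
    ENNReal.ofReal (a * (Real.log a - Real.log b) + b - a) ≤ scalarEntropy a b := by
  rcases eq_or_lt_of_le hb with rfl | hb
  · rcases eq_or_lt_of_le ha with rfl | ha
    · simp
    · rw [scalarEntropy_zero_right ha]; exact le_top
  · exact (scalarEntropy_of_pos ha hb).ge

theorem mul_log_sub_log_nonneg {a b : ℝ} (ha : 0 ≤ a) (hb : 0 < b) :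
    0 ≤ a * (Real.log a - Real.log b) + b - a := by
  rcases eq_or_lt_of_le ha with rfl | ha
  · simpa using hb.le
  · have h := Real.log_le_sub_one_of_pos (div_pos hb ha)
    rw [Real.log_div hb.ne' ha.ne'] at h
    have h2 := mul_le_mul_of_nonneg_left h ha.le
    have h3 : a * (b / a - 1) = b - a := by field_simp
    linarith

end Scalar

/-! ### Comparing weighted scalar entropies through parallel sums -/

section Comparison

open MeasureTheory Set

variable {J J' : Type*}

/-- The index set may be uncountable (`ℝ × ℝ` below), while exchanging sum and integral needs a
countable one. A dominating weight with finite total supplies a countable support. -/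
theorem tsum_lintegral_of_ne_top (μ : Measure ℝ) (f : J → ℝ → ℝ≥0∞) (w : J → ℝ≥0∞)
    (hf : ∀ j, Measurable (f j)) (hw : ∑' j, w j ≠ ⊤) (h0 : ∀ j, w j = 0 → ∀ s, f j s = 0) :
    ∑' j, ∫⁻ s, f j s ∂μ = ∫⁻ s, ∑' j, f j s ∂μ := by
  have hc : (Function.support w).Countable := Summable.countable_support_ennreal hw
  have : Countable (Function.support w) := hc.to_subtype
  have h1 : ∀ g : J → ℝ≥0∞, (∀ j, w j = 0 → g j = 0) →
      ∑' j, g j = ∑' j : Function.support w, g j := by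
    intro g hg
    refine (tsum_subtype_eq_of_support_subset ?_).symm
    intro j hj hj'
    exact hj (hg j hj')
  rw [h1 _ fun j hj => by simp [h0 j hj]]
  simp_rw [fun s => h1 (fun j => f j s) fun j hj => h0 j hj s]
  exact (lintegral_tsum fun j : Function.support w => (hf j).aemeasurable).symm

theorem ofReal_combination (m : ℝ≥0∞) {a b u v : ℝ} (ha : 0 ≤ a) (hb : 0 ≤ b) (hu : 0 ≤ u)
    (hv : 0 ≤ v) : m * ENNReal.ofReal (u * a + v * b) =
      ENNReal.ofReal u * (m * ENNReal.ofReal a) + ENNReal.ofReal v * (m * ENNReal.ofReal b) := by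
  rw [ENNReal.ofReal_add (by positivity) (by positivity), ENNReal.ofReal_mul hu,
    ENNReal.ofReal_mul hv]
  ring

theorem tsum_entropyIntegrand_add (m : J → ℝ≥0∞) (a b : J → ℝ)
    (ha : ∀ j, m j ≠ 0 → 0 ≤ a j) (hb : ∀ j, m j ≠ 0 → 0 ≤ b j)
    (hma : ∑' j, m j * ENNReal.ofReal (a j) = 1) (hmb : ∑' j, m j * ENNReal.ofReal (b j) = 1)
    {s : ℝ} (hs : 0 < s) :
    ∑' j, m j * ENNReal.ofReal (entropyIntegrand s (a j) (b j)) +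
      ∑' j, m j * ENNReal.ofReal (a j * b j / (a j + s * b j)) =
        ENNReal.ofReal (s / (1 + s) ^ 2) + ENNReal.ofReal (1 / (1 + s) ^ 2) := by
  rw [← ENNReal.tsum_add]
  have h1 : ∀ j, m j * ENNReal.ofReal (entropyIntegrand s (a j) (b j)) +
      m j * ENNReal.ofReal (a j * b j / (a j + s * b j)) =
      ENNReal.ofReal (s / (1 + s) ^ 2) * (m j * ENNReal.ofReal (a j)) +
        ENNReal.ofReal (1 / (1 + s) ^ 2) * (m j * ENNReal.ofReal (b j)) := by
    intro j
    by_cases hm : m j = 0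
    · simp [hm]
    have ha := ha j hm
    have hb := hb j hm
    rw [← ofReal_combination _ ha hb (by positivity) (by positivity), ← mul_add,
      ← ENNReal.ofReal_add (entropyIntegrand_nonneg hs.le ha hb) (by positivity),
      entropyIntegrand_add hs ha hb]
    congr 2
    ring
  simp_rw [h1]
  rw [ENNReal.tsum_add, ENNReal.tsum_mul_left, ENNReal.tsum_mul_left, hma, hmb, mul_one, mul_one]

theorem tsum_scalarEntropy (m : J → ℝ≥0∞) (a b : J → ℝ)
    (ha : ∀ j, m j ≠ 0 → 0 ≤ a j) (hb : ∀ j, m j ≠ 0 → 0 ≤ b j)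
    (hma : ∑' j, m j * ENNReal.ofReal (a j) = 1) (hmb : ∑' j, m j * ENNReal.ofReal (b j) = 1) :
    ∑' j, m j * scalarEntropy (a j) (b j) =
      ∫⁻ s in Ioi (0 : ℝ), ∑' j, m j * ENNReal.ofReal (entropyIntegrand s (a j) (b j)) := by
  rw [← tsum_lintegral_of_ne_top _ _
    (fun j => m j * ENNReal.ofReal (a j) + m j * ENNReal.ofReal (b j))
    (fun j => (measurable_entropyIntegrand _ _).const_mul _)]
  · refine tsum_congr fun j => ?_
    rw [lintegral_const_mul _ (measurable_entropyIntegrand _ _), scalarEntropy]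
  · rw [ENNReal.tsum_add, hma, hmb]; simp
  · intro j hj s
    by_cases hm : m j = 0
    · simp [hm]
    have ha := ha j hm
    have hb := hb j hm
    simp only [add_eq_zero, mul_eq_zero, hm, ENNReal.ofReal_eq_zero, false_or] at hj
    have h1 := le_antisymm hj.1 ha
    have h2 := le_antisymm hj.2 hb
    simp [h1, h2, entropyIntegrand]

/-- The sum `∑ m (a log a - a log b + b - a)` decreases if all the sums of the weighted parallel
sums `a b / (a + s b)` increase. -/
theorem tsum_scalarEntropy_le (m : J → ℝ≥0∞) (a b : J → ℝ) (m' : J' → ℝ≥0∞) (a' b' : J' → ℝ)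
    (ha : ∀ j, m j ≠ 0 → 0 ≤ a j) (hb : ∀ j, m j ≠ 0 → 0 ≤ b j)
    (hma : ∑' j, m j * ENNReal.ofReal (a j) = 1) (hmb : ∑' j, m j * ENNReal.ofReal (b j) = 1)
    (ha' : ∀ j, m' j ≠ 0 → 0 ≤ a' j) (hb' : ∀ j, m' j ≠ 0 → 0 ≤ b' j)
    (hma' : ∑' j, m' j * ENNReal.ofReal (a' j) = 1)
    (hmb' : ∑' j, m' j * ENNReal.ofReal (b' j) = 1)
    (h : ∀ s : ℝ, 0 < s → ∑' j, m j * ENNReal.ofReal (a j * b j / (a j + s * b j)) ≤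
      ∑' j, m' j * ENNReal.ofReal (a' j * b' j / (a' j + s * b' j))) :
    ∑' j, m' j * scalarEntropy (a' j) (b' j) ≤ ∑' j, m j * scalarEntropy (a j) (b j) := by
  rw [tsum_scalarEntropy m a b ha hb hma hmb, tsum_scalarEntropy m' a' b' ha' hb' hma' hmb']
  refine setLIntegral_mono' measurableSet_Ioi fun s hs => ?_
  have h1 := tsum_entropyIntegrand_add m a b ha hb hma hmb hs
  have h2 := tsum_entropyIntegrand_add m' a' b' ha' hb' hma' hmb' hs
  -- The parallel sums are part of a finite total, so they can be cancelled in `[0, ∞]`.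
  have h3 : ∑' j, m' j * ENNReal.ofReal (a' j * b' j / (a' j + s * b' j)) ≠ ⊤ := by
    intro htop
    rw [htop, add_top] at h2
    exact ENNReal.add_ne_top.2 ⟨ENNReal.ofReal_ne_top, ENNReal.ofReal_ne_top⟩ h2.symm
  refine (ENNReal.add_le_add_iff_right h3).1 ?_
  rw [h2, ← h1]
  gcongr
  exact h s hs

/-- The minimum of `s⁻¹ ∑ m a c² + ∑ m b (1 - c)²` over finitely supported `c` is at most
`∑ m a b / (a + s b)`, up to an arbitrarily small error. -/
theorem exists_finset_parallel_le (m : J → ℝ≥0∞) (a b : J → ℝ)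
    (ha : ∀ j, m j ≠ 0 → 0 ≤ a j) (hb : ∀ j, m j ≠ 0 → 0 ≤ b j)
    (hmb : ∑' j, m j * ENNReal.ofReal (b j) ≠ ⊤) {s : ℝ} (hs : 0 < s) {ε : ℝ≥0∞} (hε : 0 < ε) :
    ∃ (T : Finset J) (c : J → ℝ), (∀ j, j ∉ T → c j = 0) ∧
      ENNReal.ofReal s⁻¹ * ∑' j, ENNReal.ofReal (c j ^ 2) * (m j * ENNReal.ofReal (a j)) +
        ∑' j, ENNReal.ofReal ((1 - c j) ^ 2) * (m j * ENNReal.ofReal (b j)) ≤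
      ∑' j, m j * ENNReal.ofReal (a j * b j / (a j + s * b j)) + ε := by
  classical
  obtain ⟨T, hT⟩ := ((ENNReal.tendsto_tsum_compl_atTop_zero hmb).eventually_lt_const hε).exists
  -- On `T` the value is the minimiser of `s⁻¹ a c² + b (1 - c)²`, with minimum `a b / (a + s b)`.
  -- Off `T`, `c = 0` costs `m b`, and this tail is below `ε`.
  refine ⟨T, fun j => if j ∈ T then s * b j / (a j + s * b j) else 0,
    fun j hj => if_neg hj, ?_⟩
  have htail : ∑' j : {j // j ∉ T}, m j * ENNReal.ofReal (b j) =
      ∑' j, if j ∈ T then 0 else m j * ENNReal.ofReal (b j) := by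
    rw [← tsum_subtype_eq_of_support_subset (s := {j | j ∉ T})]
    · refine tsum_congr fun j => ?_
      rw [if_neg j.2]
    · intro j hj hj'
      exact hj (if_pos hj')
  refine le_trans ?_ (add_le_add_right hT.le _)
  rw [htail, ← ENNReal.tsum_mul_left, ← ENNReal.tsum_add, ← ENNReal.tsum_add]
  refine ENNReal.tsum_le_tsum fun j => ?_
  by_cases hm : m j = 0
  · simp [hm]
  have ha := ha j hm
  have hb := hb j hm
  by_cases hj : j ∈ T
  · simp only [hj, if_true, add_zero]
    rcases eq_or_lt_of_le (by positivity : 0 ≤ a j + s * b j) with h | h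
    · have h1 : a j = 0 := by nlinarith [mul_nonneg hs.le hb]
      have h2 : b j = 0 := by
        rcases mul_eq_zero.1 (by linarith : s * b j = 0) with h | h
        · exact absurd h hs.ne'
        · exact h
      simp [h1, h2]
    · set c := s * b j / (a j + s * b j)
      have h1 : ENNReal.ofReal s⁻¹ * (ENNReal.ofReal (c ^ 2) * (m j * ENNReal.ofReal (a j))) =
          ENNReal.ofReal (s⁻¹ * c ^ 2) * (m j * ENNReal.ofReal (a j)) := by
        rw [ENNReal.ofReal_mul (by positivity)]; ring
      rw [h1, ← ofReal_combination _ ha hb (by positivity) (by positivity)]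
      gcongr
      refine le_of_eq ?_
      simp only [c]
      field_simp
      ring
  · simp [hj]

end Comparison

/-! ### Relative entropy as a weighted sum, and its variational bound -/

section RelativeEntropy

variable {H : Type*} [NormedAddCommGroup H] [InnerProductSpace ℂ H] [CompleteSpace H]

theorem star_eigenProj (T : H →L[ℂ] H) (a : ℝ) : star (eigenProj T a) = eigenProj T a :=
  (isStarProjection_eigenProj T a).isSelfAdjoint.star_eq

theorem eigenProj_mul_self (T : H →L[ℂ] H) (a : ℝ) :
    eigenProj T a * eigenProj T a = eigenProj T a :=
  (isStarProjection_eigenProj T a).isIdempotentElem.eq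

/-- `tr (Pₐ Q_b)` for the spectral projections `Pₐ` of `τ` and `Q_b` of `σ`. -/
noncomputable def overlap (τ σ : DensityOperator H) (a b : ℝ) : ℝ≥0∞ :=
  hs (eigenProj σ.op b * eigenProj τ.op a)

theorem posTrace_eigenProj (T : H →L[ℂ] H) (a : ℝ) :
    posTrace (eigenProj T a) = hs (eigenProj T a) := by
  rw [hs, ← posTrace_star_mul_self, star_eigenProj, eigenProj_mul_self]

theorem posTrace_eigenProj_conj (τ σ : DensityOperator H) (a b : ℝ) :
    posTrace (eigenProj τ.op a * eigenProj σ.op b * eigenProj τ.op a) = overlap τ σ a b := by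
  rw [overlap, hs, ← posTrace_star_mul_self, star_mul, star_eigenProj, star_eigenProj]
  congr 1
  rw [mul_assoc (eigenProj τ.op a) (eigenProj σ.op b) (_ * _), ← mul_assoc (eigenProj σ.op b),
    eigenProj_mul_self, ← mul_assoc]

theorem overlap_comm (τ σ : DensityOperator H) (a b : ℝ) :
    overlap τ σ a b = overlap σ τ b a := by
  rw [overlap, ← hs_star, star_mul, star_eigenProj, star_eigenProj, overlap]

theorem nonneg_left_of_overlap_ne_zero {τ σ : DensityOperator H} {a b : ℝ}
    (h : overlap τ σ a b ≠ 0) : 0 ≤ a := by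
  by_contra hlt
  exact h (by rw [overlap, τ.eigenProj_of_neg (not_le.1 hlt), mul_zero, hs_zero])

theorem nonneg_right_of_overlap_ne_zero {τ σ : DensityOperator H} {a b : ℝ}
    (h : overlap τ σ a b ≠ 0) : 0 ≤ b :=
  nonneg_left_of_overlap_ne_zero (by rwa [overlap_comm] at h)

/-- Together with `weight_eq_tsum_prod_right` this expresses both costs through the same blocks `Q_b
A Pₐ`, so the minimisation over `A` splits into scalar problems indexed by `(a, b)`. -/
theorem weight_eq_tsum_prod_left (τ σ : DensityOperator H) (A : H →L[ℂ] H) :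
    τ.weight A = ∑' j : ℝ × ℝ,
      ENNReal.ofReal j.1 * hs (eigenProj σ.op j.2 * A * eigenProj τ.op j.1) := by
  rw [τ.weight_eq_tsum_tsum σ.spectralMeasure, ENNReal.tsum_prod']
  rfl

theorem weight_eq_tsum_prod_right (τ σ : DensityOperator H) (A : H →L[ℂ] H) :
    σ.weight (star A) = ∑' j : ℝ × ℝ,
      ENNReal.ofReal j.2 * hs (eigenProj σ.op j.2 * A * eigenProj τ.op j.1) := by
  rw [σ.weight_eq_tsum_tsum τ.spectralMeasure, ENNReal.tsum_comm, ENNReal.tsum_prod']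
  refine tsum_congr fun a => tsum_congr fun b => ?_
  rw [← hs_star]
  simp only [star_mul, star_star, star_eigenProj, ProjectionMeasure.star_proj, mul_assoc]
  rfl

theorem tsum_overlap_left (τ σ : DensityOperator H) :
    ∑' j : ℝ × ℝ, overlap τ σ j.1 j.2 * ENNReal.ofReal j.1 = 1 := by
  rw [← τ.weight_one, weight_eq_tsum_prod_left τ σ]
  simp only [mul_one, overlap, mul_comm]

theorem tsum_overlap_right (τ σ : DensityOperator H) :
    ∑' j : ℝ × ℝ, overlap τ σ j.1 j.2 * ENNReal.ofReal j.2 = 1 := by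
  rw [← σ.weight_one, ← star_one, weight_eq_tsum_prod_right τ σ]
  simp only [mul_one, overlap, mul_comm]

theorem closure_range_eq (τ : DensityOperator H) :
    closure (Set.range τ.op) = ((LinearMap.ker τ.op.toLinearMap)ᗮ : Submodule ℂ H) := by
  have h := τ.op.orthogonal_ker
  rw [← ContinuousLinearMap.star_eq_adjoint, τ.isPositive.isSelfAdjoint.star_eq] at h
  rw [h]
  rfl

/-- The closed range of a self-adjoint operator is the orthogonal complement of its kernel, so the
condition says `ker σ ⊆ ker τ`: the projection `Q₀` is orthogonal to every `Pₐ` with `a ≠ 0`. -/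
theorem closure_range_subset_iff (τ σ : DensityOperator H) :
    closure (Set.range τ.op) ⊆ closure (Set.range σ.op) ↔
      ∀ a : ℝ, a ≠ 0 → overlap τ σ a 0 = 0 := by
  have hcl : ∀ τ : DensityOperator H, (LinearMap.ker τ.op.toLinearMap)ᗮᗮ =
      LinearMap.ker τ.op.toLinearMap := fun τ => by
    rw [Submodule.orthogonal_orthogonal_eq_closure]
    exact (ContinuousLinearMap.isClosed_ker τ.op).submodule_topologicalClosure_eq
  have hiff : closure (Set.range τ.op) ⊆ closure (Set.range σ.op) ↔
      ∀ x, σ.op x = 0 → τ.op x = 0 := by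
    rw [closure_range_eq, closure_range_eq, SetLike.coe_subset_coe]
    constructor
    · intro h
      have h1 := Submodule.orthogonal_le h
      rw [hcl, hcl] at h1
      exact h1
    · exact fun h => Submodule.orthogonal_le h
  rw [hiff]
  constructor
  · intro h a ha
    rw [overlap_comm, overlap, hs_eq_zero]
    ext x
    have h0 : τ.op (eigenProj σ.op 0 x) = 0 := by
      refine h _ ?_
      have := congrArg (fun T : H →L[ℂ] H => T x) (mul_eigenProj σ.op 0)
      simpa using this
    have h1 : eigenProj τ.op 0 (eigenProj σ.op 0 x) = eigenProj σ.op 0 x :=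
      eigenProj_apply_of_eq (by simpa using h0)
    rw [mul_apply_eq_comp, ← h1, ← mul_apply_eq_comp, τ.eigenProj_mul_eigenProj ha]
    rfl
  · intro h x hx
    have hx0 : eigenProj σ.op 0 x = x := eigenProj_apply_of_eq (by simpa using hx)
    have h1 := (τ.hasSum_eigenProj x).mapL τ.op
    refine h1.unique ?_
    convert hasSum_zero using 1
    funext a
    by_cases ha : a = 0
    · subst ha
      have := congrArg (fun T : H →L[ℂ] H => T x) (mul_eigenProj τ.op 0)
      simpa using this
    · have h2 := h a ha
      rw [overlap_comm, overlap, hs_eq_zero] at h2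
      have h3 := congrArg (fun T : H →L[ℂ] H => T x) h2
      simp only [mul_apply_eq_comp, hx0] at h3
      simp [h3]

/-- The integral form absorbs the case distinction: a failure of the support condition is an overlap
at `(a, 0)` with `a > 0`, where `scalarEntropy` is infinite. -/
theorem relativeEntropy_eq_tsum (τ σ : DensityOperator H) :
    relativeEntropy τ σ =
      ∑' j : ℝ × ℝ, overlap τ σ j.1 j.2 * scalarEntropy j.1 j.2 := by
  rw [relativeEntropy]
  simp_rw [posTrace_eigenProj_conj]
  split_ifs with h
  · rw [closure_range_subset_iff] at h
    rw [ENNReal.tsum_prod' (f := fun j : ℝ × ℝ => overlap τ σ j.1 j.2 * scalarEntropy j.1 j.2)]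
    refine tsum_congr fun a => tsum_congr fun b => ?_
    by_cases hm : overlap τ σ a b = 0
    · simp [hm]
    have ha := nonneg_left_of_overlap_ne_zero hm
    rcases eq_or_lt_of_le (nonneg_right_of_overlap_ne_zero hm) with rfl | hb
    · have ha0 : a = 0 := by
        by_contra ha0
        exact hm (h a ha0)
      simp [ha0, scalarEntropy_zero_zero]
    · rw [scalarEntropy_of_pos ha hb]
  · rw [closure_range_subset_iff] at h
    push Not at h
    obtain ⟨a, ha, hm⟩ := h
    have ha' : 0 < a := lt_of_le_of_ne (nonneg_left_of_overlap_ne_zero hm) ha.symm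
    refine (ENNReal.tsum_eq_top_of_eq_top ⟨(a, 0), ?_⟩).symm
    simp only
    rw [scalarEntropy_zero_right ha', ENNReal.mul_top hm]

/-- Blockwise, `Q_b A Pₐ + Q_b (1 - A) Pₐ = Q_b Pₐ`, and `hs_parallelogram` with coefficients `s⁻¹
a` and `b` has the parallel sum `a b / (a + s b)`. -/
theorem tsum_parallel_le_weight (τ σ : DensityOperator H) (A : H →L[ℂ] H) {s : ℝ} (hs : 0 < s) :
    ∑' j : ℝ × ℝ, overlap τ σ j.1 j.2 * ENNReal.ofReal (j.1 * j.2 / (j.1 + s * j.2)) ≤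
      ENNReal.ofReal s⁻¹ * τ.weight A + σ.weight (star (1 - A)) := by
  rw [weight_eq_tsum_prod_left τ σ, weight_eq_tsum_prod_right τ σ, ← ENNReal.tsum_mul_left,
    ← ENNReal.tsum_add]
  refine ENNReal.tsum_le_tsum fun ⟨a, b⟩ => ?_
  simp only
  by_cases hm : overlap τ σ a b = 0
  · simp [hm]
  rcases eq_or_lt_of_le (nonneg_left_of_overlap_ne_zero hm) with rfl | ha
  · simp
  rcases eq_or_lt_of_le (nonneg_right_of_overlap_ne_zero hm) with rfl | hb
  · simp
  have h := hs_parallelogram (eigenProj σ.op b * A * eigenProj τ.op a)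
    (eigenProj σ.op b * (1 - A) * eigenProj τ.op a) (s⁻¹ * a) b (by positivity) hb
  have h1 : eigenProj σ.op b * A * eigenProj τ.op a +
      eigenProj σ.op b * (1 - A) * eigenProj τ.op a = eigenProj σ.op b * eigenProj τ.op a := by
    noncomm_ring
  have h2 : s⁻¹ * a * b / (s⁻¹ * a + b) = a * b / (a + s * b) := by field_simp
  rw [h1, h2, ENNReal.ofReal_mul (by positivity)] at h
  rw [mul_comm, ← mul_assoc]
  exact h

/-- A comparison of the relative entropy with the relative entropy of two weighted families,
given operators which approximately implement finitely supported multipliers. -/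
theorem tsum_scalarEntropy_le_relativeEntropy {J : Type*} (τ σ : DensityOperator H)
    (m : J → ℝ≥0∞) (a b : J → ℝ)
    (ha : ∀ j, m j ≠ 0 → 0 ≤ a j) (hb : ∀ j, m j ≠ 0 → 0 ≤ b j)
    (hma : ∑' j, m j * ENNReal.ofReal (a j) = 1) (hmb : ∑' j, m j * ENNReal.ofReal (b j) = 1)
    (h : ∀ (T : Finset J) (c : J → ℝ), (∀ j, j ∉ T → c j = 0) → ∀ ε : ℝ≥0∞, 0 < ε →
      ∃ A : H →L[ℂ] H, τ.weight A ≤ ∑' j, ENNReal.ofReal (c j ^ 2) * (m j * ENNReal.ofReal (a j)) ∧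
      σ.weight (star (1 - A)) ≤
        ∑' j, ENNReal.ofReal ((1 - c j) ^ 2) * (m j * ENNReal.ofReal (b j)) + ε) :
    ∑' j, m j * scalarEntropy (a j) (b j) ≤ relativeEntropy τ σ := by
  rw [relativeEntropy_eq_tsum]
  refine tsum_scalarEntropy_le _ _ _ _ _ _ (fun j => nonneg_left_of_overlap_ne_zero)
    (fun j => nonneg_right_of_overlap_ne_zero) (tsum_overlap_left τ σ) (tsum_overlap_right τ σ)
    ha hb hma hmb fun s hs => ?_
  refine ENNReal.le_of_forall_pos_le_add fun ε hε _ => ?_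
  -- One half of `ε` pays for making `c` finitely supported, the other for the operator implementing
  -- it.
  have hε2 : (0 : ℝ≥0∞) < (ε : ℝ≥0∞) / 2 := ENNReal.half_pos (ENNReal.coe_pos.2 hε).ne'
  obtain ⟨T, c, hc, hle⟩ := exists_finset_parallel_le m a b ha hb
    (by rw [hmb]; exact ENNReal.one_ne_top) hs hε2
  obtain ⟨A, hA1, hA2⟩ := h T c hc _ hε2
  refine (tsum_parallel_le_weight τ σ A hs).trans
    ((add_le_add (mul_le_mul_right hA1 _) hA2).trans ?_)
  rw [← add_assoc]
  refine (add_le_add_left hle _).trans_eq ?_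
  rw [add_assoc, ENNReal.add_halves]

theorem ProjectionMeasure.proj_mul_proj {ι : Type*} [DecidableEq ι] (E : ProjectionMeasure ι H)
    (i j : ι) : E.proj i * E.proj j = if i = j then E.proj i else 0 := by
  split_ifs with h
  · rw [← h, E.proj_mul_self]
  · exact E.orthogonal i j h

/-- The finite sum acts as the scalar `c (i, i')` on each block, so every finitely supported choice
of scalars is realised by a bounded operator. -/
theorem ProjectionMeasure.multiplier {ι ι' : Type*} (E : ProjectionMeasure ι H)
    (F : ProjectionMeasure ι' H) (T : Finset (ι × ι')) (c : ι × ι' → ℝ)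
    (hc : ∀ j, j ∉ T → c j = 0) (i : ι) (i' : ι') :
    F.proj i' * (∑ j ∈ T, (c j : ℂ) • (F.proj j.2 * E.proj j.1)) * E.proj i =
      (c (i, i') : ℂ) • (F.proj i' * E.proj i) := by
  classical
  rw [Finset.mul_sum, Finset.sum_mul]
  have h1 : ∀ j : ι × ι', F.proj i' * ((c j : ℂ) • (F.proj j.2 * E.proj j.1)) * E.proj i =
      if (i, i') = j then (c (i, i') : ℂ) • (F.proj i' * E.proj i) else 0 := by
    rintro ⟨k, k'⟩
    rw [mul_smul_comm, smul_mul_assoc, mul_assoc, mul_assoc, E.proj_mul_proj, ← mul_assoc,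
      F.proj_mul_proj]
    by_cases h : (i, i') = (k, k')
    · rw [if_pos h]
      obtain ⟨rfl, rfl⟩ := Prod.mk.inj h
      simp
    · rw [if_neg h]
      by_cases hk : i' = k'
      · have : k ≠ i := fun hki => h (by rw [hki, hk])
        simp [this]
      · simp [hk]
  simp_rw [h1]
  rw [Finset.sum_ite_eq]
  split_ifs with h
  · rfl
  · simp [hc _ h]

variable {H' : Type*} [NormedAddCommGroup H'] [InnerProductSpace ℂ H'] [CompleteSpace H']

/-- Monotonicity of the relative entropy under maps whose duals satisfy the Schwarz inequality. -/
theorem relativeEntropy_le_of_forall_exists (τ σ : DensityOperator H) (τ' σ' : DensityOperator H')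
    (h : ∀ (B : H' →L[ℂ] H') (ε : ℝ≥0∞), 0 < ε → ∃ A : H →L[ℂ] H,
      τ.weight A ≤ τ'.weight B ∧ σ.weight (star (1 - A)) ≤ σ'.weight (star (1 - B)) + ε) :
    relativeEntropy τ' σ' ≤ relativeEntropy τ σ := by
  rw [relativeEntropy_eq_tsum τ' σ']
  refine tsum_scalarEntropy_le_relativeEntropy τ σ _ _ _ (fun j => nonneg_left_of_overlap_ne_zero)
    (fun j => nonneg_right_of_overlap_ne_zero) (tsum_overlap_left τ' σ') (tsum_overlap_right τ' σ')
    fun T c hc ε hε => ?_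
  have hmul := τ'.spectralMeasure.multiplier σ'.spectralMeasure T c hc
  set B := ∑ j ∈ T, (c j : ℂ) • (σ'.spectralMeasure.proj j.2 * τ'.spectralMeasure.proj j.1)
  obtain ⟨A, hA1, hA2⟩ := h B ε hε
  refine ⟨A, hA1.trans_eq ?_, hA2.trans_eq (congrArg (· + ε) ?_)⟩
  · rw [weight_eq_tsum_prod_left τ' σ']
    refine tsum_congr fun ⟨a, b⟩ => ?_
    have h1 := hmul a b
    simp only
    rw [show eigenProj σ'.op b * B * eigenProj τ'.op a =
      (c (a, b) : ℂ) • (eigenProj σ'.op b * eigenProj τ'.op a) from h1, hs_smul, overlap]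
    ring
  · rw [weight_eq_tsum_prod_right τ' σ']
    refine tsum_congr fun ⟨a, b⟩ => ?_
    have h1 : eigenProj σ'.op b * B * eigenProj τ'.op a =
      (c (a, b) : ℂ) • (eigenProj σ'.op b * eigenProj τ'.op a) := hmul a b
    have h2 : eigenProj σ'.op b * (1 - B) * eigenProj τ'.op a =
        ((1 - c (a, b) : ℝ) : ℂ) • (eigenProj σ'.op b * eigenProj τ'.op a) := by
      rw [mul_sub, sub_mul, h1, mul_one]
      push_cast
      rw [sub_smul, one_smul]
    simp only
    rw [h2, hs_smul, overlap]
    ring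

end RelativeEntropy

/-! ### Traces against a state, and weights -/

section Trace

variable {H : Type*} [NormedAddCommGroup H] [InnerProductSpace ℂ H] [CompleteSpace H]

theorem hs_mul_le (A B : H →L[ℂ] H) : hs (A * B) ≤ ENNReal.ofReal (‖A‖ ^ 2) * hs B := by
  simp only [hs, ← ENNReal.tsum_mul_left]
  refine ENNReal.tsum_le_tsum fun i => ?_
  rw [← ENNReal.ofReal_mul (by positivity), ← mul_pow]
  refine ENNReal.ofReal_le_ofReal ?_
  gcongr
  exact A.le_opNorm _

theorem summable_norm_inner_sq {A : H →L[ℂ] H} (hA : hs A ≠ ⊤) :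
    Summable fun p : basisIndex H × basisIndex H =>
      ‖⟪basis H p.2, A (basis H p.1)⟫_ℂ‖ ^ 2 := by
  have h1 : ∑' p : basisIndex H × basisIndex H,
      ENNReal.ofReal (‖⟪basis H p.2, A (basis H p.1)⟫_ℂ‖ ^ 2) ≠ ⊤ := by
    rw [ENNReal.tsum_prod' (f := fun p : basisIndex H × basisIndex H =>
      ENNReal.ofReal (‖⟪basis H p.2, A (basis H p.1)⟫_ℂ‖ ^ 2))]
    simp_rw [parseval]
    exact hA
  refine (ENNReal.summable_toReal h1).congr fun p => ?_
  rw [ENNReal.toReal_ofReal (by positivity)]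

/-- Cyclicity `tr X*Y = tr YX*`: expand in matrix entries and exchange the sums. -/
theorem tsum_inner_comm {X Y : H →L[ℂ] H} (hX : hs X ≠ ⊤) (hY : hs Y ≠ ⊤) :
    ∑' i, ⟪X (basis H i), Y (basis H i)⟫_ℂ =
      ∑' i, ⟪star Y (basis H i), star X (basis H i)⟫_ℂ := by
  have hsum : Summable (Function.uncurry fun i j : basisIndex H =>
      ⟪X (basis H i), basis H j⟫_ℂ * ⟪basis H j, Y (basis H i)⟫_ℂ) := by
    -- The entries satisfy `|x y| ≤ x² + y²`, and the squares are summable by the Hilbert-Schmidt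
    -- assumption.
    refine Summable.of_norm_bounded
      ((summable_norm_inner_sq hX).add (summable_norm_inner_sq hY)) fun p => ?_
    simp only [Function.uncurry, norm_mul]
    rw [norm_inner_symm]
    nlinarith [sq_nonneg (‖⟪basis H p.2, X (basis H p.1)⟫_ℂ‖ - ‖⟪basis H p.2, Y (basis H p.1)⟫_ℂ‖),
      norm_nonneg ⟪basis H p.2, X (basis H p.1)⟫_ℂ, norm_nonneg ⟪basis H p.2, Y (basis H p.1)⟫_ℂ]
  calc ∑' i, ⟪X (basis H i), Y (basis H i)⟫_ℂ
      = ∑' i, ∑' j, ⟪X (basis H i), basis H j⟫_ℂ * ⟪basis H j, Y (basis H i)⟫_ℂ :=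
        tsum_congr fun i => ((basis H).tsum_inner_mul_inner _ _).symm
    _ = ∑' j, ∑' i, ⟪X (basis H i), basis H j⟫_ℂ * ⟪basis H j, Y (basis H i)⟫_ℂ :=
        hsum.tsum_comm.symm
    _ = _ := tsum_congr fun j => ?_
  rw [← (basis H).tsum_inner_mul_inner]
  refine tsum_congr fun i => ?_
  simp only [ContinuousLinearMap.star_eq_adjoint, ContinuousLinearMap.adjoint_inner_left,
    ContinuousLinearMap.adjoint_inner_right]
  rw [mul_comm]

theorem DensityOperator.exists_sqrt (τ : DensityOperator H) :
    ∃ R : H →L[ℂ] H, star R = R ∧ R * R = τ.op ∧ hs R = 1 ∧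
      ∀ A, τ.weight A = hs (A * R) := by
  obtain ⟨R, hR, hRR⟩ := QuantumInfo.exists_sqrt τ.isPositive
  refine ⟨R, hR, hRR, ?_, fun A => ?_⟩
  · rw [hs, ← posTrace_star_mul_self, hR, hRR, τ.posTrace_eq_one]
  · rw [← hs_star, hs, ← posTrace_star_mul_self, weight, star_star, star_mul, hR, ← hRR]
    simp only [mul_assoc]

theorem DensityOperator.weight_ne_top (τ : DensityOperator H) (A : H →L[ℂ] H) :
    τ.weight A ≠ ⊤ := by
  obtain ⟨R, hR, hRR, h1, hw⟩ := τ.exists_sqrt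
  rw [hw]
  refine ne_top_of_le_ne_top ?_ (hs_mul_le A R)
  rw [h1, mul_one]
  exact ENNReal.ofReal_ne_top

/-- Links the complex trace of the duality relation to weights in `[0, ∞]`. Writing `τ = R R` with
`R` Hilbert-Schmidt, cyclicity moves one factor and leaves `∑ ‖A R eᵢ‖²`. -/
theorem DensityOperator.trace_mul_star_mul (τ : DensityOperator H) (A : H →L[ℂ] H) :
    trace (τ.op * (star A * A)) = ((τ.weight A).toReal : ℂ) := by
  obtain ⟨R, hR, hRR, h1, hw⟩ := τ.exists_sqrt
  have hY : hs (R * (star A * A)) ≠ ⊤ := by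
    rw [← hs_star, star_mul, hR]
    refine ne_top_of_le_ne_top ?_ (hs_mul_le (star (star A * A)) R)
    rw [h1, mul_one]
    exact ENNReal.ofReal_ne_top
  have h2 : ∀ i, ⟪basis H i, (τ.op * (star A * A)) (basis H i)⟫_ℂ =
      ⟪R (basis H i), (R * (star A * A)) (basis H i)⟫_ℂ := by
    intro i
    rw [← ContinuousLinearMap.adjoint_inner_right, ← ContinuousLinearMap.star_eq_adjoint, hR,
      ← mul_apply_eq_comp, ← hRR, mul_assoc R R]
  rw [trace]
  simp_rw [h2]
  rw [tsum_inner_comm (by rw [h1]; exact ENNReal.one_ne_top) hY, hR, star_mul, hR, star_mul,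
    star_star]
  have h3 : ∀ i, ⟪(star A * A * R) (basis H i), R (basis H i)⟫_ℂ =
      ((ENNReal.ofReal (‖(A * R) (basis H i)‖ ^ 2)).toReal : ℂ) := by
    intro i
    rw [mul_assoc, mul_apply_eq_comp, ContinuousLinearMap.star_eq_adjoint,
      ContinuousLinearMap.adjoint_inner_left, ← mul_apply_eq_comp, inner_self_eq_norm_sq_to_K,
      ENNReal.toReal_ofReal (by positivity)]
    norm_cast
  simp_rw [h3]
  rw [← Complex.ofReal_tsum, hw, hs, ENNReal.tsum_toReal_eq fun i => ENNReal.ofReal_ne_top]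

theorem DensityOperator.trace_op (τ : DensityOperator H) : trace τ.op = 1 := by
  have h := τ.trace_mul_star_mul 1
  simpa [τ.weight_one] using h

theorem DensityOperator.weight_le_weight (τ : DensityOperator H) {A B : H →L[ℂ] H}
    (h : (star B * B - star A * A).IsPositive) : τ.weight A ≤ τ.weight B := by
  obtain ⟨R, hR, hRR, h1, hw⟩ := τ.exists_sqrt
  rw [hw, hw]
  refine ENNReal.tsum_le_tsum fun i => ENNReal.ofReal_le_ofReal ?_
  rw [mul_apply_eq_comp, mul_apply_eq_comp, ← inner_star_mul_self, ← inner_star_mul_self]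
  have h2 := h.re_inner_nonneg_right (R (basis H i))
  rw [sub_apply, inner_sub_right, map_sub] at h2
  exact sub_nonneg.1 h2

theorem DensityOperator.weight_smul (τ : DensityOperator H) (c : ℝ) (A : H →L[ℂ] H) :
    τ.weight ((c : ℂ) • A) = ENNReal.ofReal (c ^ 2) * τ.weight A := by
  obtain ⟨R, hR, hRR, h1, hw⟩ := τ.exists_sqrt
  rw [hw, hw, smul_mul_assoc, hs_smul]

theorem ProjectionMeasure.tsum_weight_proj_mul {ι : Type*} (E : ProjectionMeasure ι H)
    (τ : DensityOperator H) (A : H →L[ℂ] H) : ∑' i, τ.weight (E.proj i * A) = τ.weight A := by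
  obtain ⟨R, hR, hRR, h1, hw⟩ := τ.exists_sqrt
  simp_rw [hw, mul_assoc]
  exact E.tsum_hs_proj_mul _

theorem ProjectionMeasure.weight_proj_mul_le {ι : Type*} (E : ProjectionMeasure ι H)
    (τ : DensityOperator H) (i : ι) (A : H →L[ℂ] H) : τ.weight (E.proj i * A) ≤ τ.weight A := by
  rw [← E.tsum_weight_proj_mul τ A]
  exact ENNReal.le_tsum i

theorem DensityOperator.weight_ofSum {κ : Type*} (T : κ → H →L[ℂ] H)
    (hT : ∀ k, (T k).IsPositive) (h1 : ∑' k, posTrace (T k) = 1) (A : H →L[ℂ] H) :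
    (DensityOperator.ofSum T hT h1).weight A = ∑' k, posTrace (A * T k * star A) := by
  simp only [weight, posTrace, inner_conj_star]
  rw [ENNReal.tsum_comm]
  refine tsum_congr fun i => ?_
  have h2 := Complex.hasSum_re ((((summable_of_tsum_posTrace hT h1).hasSum).mapL
    (ContinuousLinearMap.apply ℂ H (star A (basis H i)))).mapL (innerSL ℂ (star A (basis H i))))
  simp only [ContinuousLinearMap.apply_apply, innerSL_apply_apply] at h2
  change ENNReal.ofReal (⟪_, (∑' k, T k) _⟫_ℂ).re = _
  rw [← h2.tsum_eq, ENNReal.ofReal_tsum_of_nonneg _ h2.summable]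
  exact fun k => (hT k).re_inner_nonneg_right _

end Trace

/-! ### Monotonicity under channels, pinchings and measurements -/

section Channels

variable {H H' : Type*} [NormedAddCommGroup H] [InnerProductSpace ℂ H] [CompleteSpace H]
  [NormedAddCommGroup H'] [InnerProductSpace ℂ H'] [CompleteSpace H']

theorem weight_codingChannel {κ : Type*} (σ : κ → DensityOperator H) (p : PMF κ)
    (A : H →L[ℂ] H) : (codingChannel σ p).weight A = ∑' k, p k * (σ k).weight A := by
  rw [codingChannel, DensityOperator.weight_ofSum]
  refine tsum_congr fun k => ?_
  rw [mul_smul_comm, smul_mul_assoc, posTrace_smul ENNReal.toReal_nonneg,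
    ENNReal.ofReal_toReal (p.apply_ne_top _), DensityOperator.weight]

theorem weight_pinching {ι : Type*} (E : ProjectionMeasure ι H) (τ : DensityOperator H)
    (A : H →L[ℂ] H) : (pinching E τ).weight A = ∑' i, τ.weight (A * E.proj i) := by
  rw [pinching, DensityOperator.weight_ofSum]
  refine tsum_congr fun i => ?_
  rw [DensityOperator.weight, star_mul, E.star_proj]
  simp only [mul_assoc]

/-- The pure state of a unit vector. -/
noncomputable def pureState (x : H) (hx : ‖x‖ = 1) : DensityOperator H where
  op := InnerProductSpace.rankOne ℂ x x
  isPositive := InnerProductSpace.isPositive_rankOne_self x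
  posTrace_eq_one := by
    have h := parseval x
    rw [hx, one_pow, ENNReal.ofReal_one] at h
    rw [← h, posTrace]
    refine tsum_congr fun i => ?_
    rw [InnerProductSpace.rankOne_apply, inner_smul_right, ← inner_conj_symm x,
      ← Complex.normSq_eq_conj_mul_self, Complex.ofReal_re, Complex.normSq_eq_norm_sq]

theorem trace_pureState_mul (x : H) (hx : ‖x‖ = 1) (M : H →L[ℂ] H) :
    trace ((pureState x hx).op * M) = ⟪x, M x⟫_ℂ := by
  rw [← ContinuousLinearMap.adjoint_inner_left, ← (basis H).tsum_inner_mul_inner, trace]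
  refine tsum_congr fun i => ?_
  rw [ContinuousLinearMap.adjoint_inner_left, mul_apply_eq_comp, pureState,
    InnerProductSpace.rankOne_apply, inner_smul_right]

/-- Duality with `B = 1`, tested on pure states, makes the quadratic form of `Φ 1 - 1` vanish; over
`ℂ` this determines the operator. -/
theorem IsDualMap.map_one {Λ : DensityOperator H → DensityOperator H'}
    {Φ : (H' →L[ℂ] H') →ₗ[ℂ] (H →L[ℂ] H)} (h : IsDualMap Λ Φ) : Φ 1 = 1 := by
  rw [← sub_eq_zero, ← ContinuousLinearMap.coe_inj, ContinuousLinearMap.toLinearMap_zero,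
    ← inner_map_self_eq_zero]
  intro x
  rcases eq_or_ne x 0 with rfl | hx
  · simp
  have hn : ‖x‖ ≠ 0 := norm_ne_zero_iff.2 hx
  have hu : ‖((‖x‖⁻¹ : ℝ) : ℂ) • x‖ = 1 := by
    rw [norm_smul]; simp [hn]
  have h1 := h (pureState _ hu) 1
  rw [mul_one, DensityOperator.trace_op, trace_pureState_mul] at h1
  have h2 : ⟪((‖x‖⁻¹ : ℝ) : ℂ) • x, (Φ 1 - 1) (((‖x‖⁻¹ : ℝ) : ℂ) • x)⟫_ℂ = 0 := by
    rw [sub_apply, inner_sub_right, ← h1, one_apply_eq_self,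
      inner_self_eq_norm_sq_to_K, hu]
    simp
  rw [map_smul, inner_smul_left, inner_smul_right] at h2
  have h3 : ((‖x‖⁻¹ : ℝ) : ℂ) ≠ 0 := by exact_mod_cast inv_ne_zero hn
  have h4 : ⟪x, (Φ 1 - 1) x⟫_ℂ = 0 := by
    rw [Complex.conj_ofReal] at h2
    exact (mul_eq_zero.1 ((mul_eq_zero.1 h2).resolve_left h3)).resolve_left h3
  change ⟪(Φ 1 - 1) x, x⟫_ℂ = 0
  rw [← inner_conj_symm, h4, map_zero]

section CompletelyPositive

variable {Φ : (H' →L[ℂ] H') →ₗ[ℂ] (H →L[ℂ] H)}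

theorem isPositive_map_star_mul_self
    (hcp : ∀ (n : ℕ) (A : Fin n → H →L[ℂ] H) (B : Fin n → H' →L[ℂ] H'),
      (∑ k, ∑ j, star (A k) * Φ (star (B k) * B j) * A j).IsPositive)
    (B : H' →L[ℂ] H') : (Φ (star B * B)).IsPositive := by
  simpa using hcp 1 (fun _ => 1) (fun _ => B)

/-- By polarisation `Φ C* + Φ C` is a real combination of positive operators, hence self-adjoint;
the cases `C = B` and `C = i B` together give the claim. -/
theorem map_star_of_completelyPositive
    (hcp : ∀ (n : ℕ) (A : Fin n → H →L[ℂ] H) (B : Fin n → H' →L[ℂ] H'),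
      (∑ k, ∑ j, star (A k) * Φ (star (B k) * B j) * A j).IsPositive)
    (B : H' →L[ℂ] H') : Φ (star B) = star (Φ B) := by
  have hsa : ∀ C, star (Φ (star C * C)) = Φ (star C * C) := fun C =>
    (isPositive_map_star_mul_self hcp C).isSelfAdjoint.star_eq
  have h1 : ∀ C, star (Φ (star C) + Φ C) = Φ (star C) + Φ C := by
    intro C
    have h2 : Φ (star C) + Φ C =
        Φ (star (C + 1) * (C + 1)) - Φ (star C * C) - Φ (star 1 * 1) := by
      rw [← map_add, ← map_sub, ← map_sub]
      congr 1
      rw [star_add, star_one]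
      noncomm_ring
    rw [h2, star_sub, star_sub, hsa, hsa, hsa]
  have h3 := h1 B
  have h4 := h1 (Complex.I • B)
  simp only [star_smul, map_smul, star_add, Complex.star_def, Complex.conj_I, star_neg,
    neg_smul, map_neg] at h3 h4
  have h5 := congrArg (fun T => Complex.I • T) h4
  simp only [smul_add, smul_neg, smul_smul, Complex.I_mul_I, neg_smul, one_smul,
    neg_neg] at h5
  have h6 : (2 : ℂ) • Φ (star B) = (2 : ℂ) • star (Φ B) := by
    rw [two_smul, two_smul]
    have h7 : Φ (star B) + Φ B + (Φ (star B) - Φ B) =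
      star (Φ (star B)) + star (Φ B) + (star (Φ B) - star (Φ (star B))) := by
      rw [h3]
      congr 1
      rw [sub_eq_add_neg, sub_eq_add_neg]
      rw [← h5]
      abel
    calc _ = Φ (star B) + Φ B + (Φ (star B) - Φ B) := by abel
      _ = _ := by rw [h7]; abel
  exact smul_right_injective _ (two_ne_zero' ℂ) h6

/-- Two-term complete positivity suffices: with `A = (1, -Φ B)` and `(B, 1)` the double sum
collapses to the difference, since `Φ` is unital. -/
theorem schwarz_of_completelyPositive
    (hcp : ∀ (n : ℕ) (A : Fin n → H →L[ℂ] H) (B : Fin n → H' →L[ℂ] H'),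
      (∑ k, ∑ j, star (A k) * Φ (star (B k) * B j) * A j).IsPositive)
    (h1 : Φ 1 = 1) (B : H' →L[ℂ] H') :
    (Φ (star B * B) - star (Φ B) * Φ B).IsPositive := by
  have h := hcp 2 ![1, -Φ B] ![B, 1]
  simp only [Fin.sum_univ_two, Matrix.cons_val_zero, Matrix.cons_val_one, star_one, one_mul,
    mul_one, star_neg, h1] at h
  rw [map_star_of_completelyPositive hcp] at h
  convert h using 1
  noncomm_ring

end CompletelyPositive

theorem IsDualMap.weight_eq {Λ : DensityOperator H → DensityOperator H'}
    {Φ : (H' →L[ℂ] H') →ₗ[ℂ] (H →L[ℂ] H)} (h : IsDualMap Λ Φ) {B : H' →L[ℂ] H'}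
    {S : H →L[ℂ] H} (hS : star S * S = Φ (star B * B)) (τ : DensityOperator H) :
    (Λ τ).weight B = τ.weight S := by
  have h1 := h τ (star B * B)
  rw [DensityOperator.trace_mul_star_mul, ← hS, DensityOperator.trace_mul_star_mul] at h1
  exact (ENNReal.toReal_eq_toReal_iff' (DensityOperator.weight_ne_top _ _)
    (DensityOperator.weight_ne_top _ _)).1 (by exact_mod_cast h1)

/-- The point is that `S`, a square root of `Φ (B* B)`, does not depend on the state. The channel is
only a map on states, and this recovers its compatibility with mixtures. -/
theorem IsCompletelyPositiveChannel.exists_weight_eq {Λ : DensityOperator H → DensityOperator H'}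
    (h : IsCompletelyPositiveChannel Λ) (B : H' →L[ℂ] H') :
    ∃ S : H →L[ℂ] H, ∀ τ, (Λ τ).weight B = τ.weight S := by
  obtain ⟨Φ, hd, hcp⟩ := h
  obtain ⟨S, hS, hSS⟩ := exists_sqrt (isPositive_map_star_mul_self hcp B)
  exact ⟨S, hd.weight_eq (by rw [hS, hSS])⟩

/-- The relative entropy decreases under completely positive channels. -/
theorem IsCompletelyPositiveChannel.relativeEntropy_le
    {Λ : DensityOperator H → DensityOperator H'} (h : IsCompletelyPositiveChannel Λ)
    (τ σ : DensityOperator H) : relativeEntropy (Λ τ) (Λ σ) ≤ relativeEntropy τ σ := by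
  obtain ⟨Φ, hd, hcp⟩ := h
  have key : ∀ (ω : DensityOperator H) (B : H' →L[ℂ] H'),
      ω.weight (Φ B) ≤ (Λ ω).weight B := by
    intro ω B
    obtain ⟨S, hS, hSS⟩ := exists_sqrt (isPositive_map_star_mul_self hcp B)
    rw [hd.weight_eq (S := S) (by rw [hS, hSS])]
    refine ω.weight_le_weight ?_
    rw [hS, hSS]
    exact schwarz_of_completelyPositive hcp hd.map_one B
  refine relativeEntropy_le_of_forall_exists _ _ _ _ fun B ε _ => ⟨Φ B, key τ B, ?_⟩
  refine le_trans ?_ le_self_add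
  have h1 : star (1 - Φ B) = Φ (star (1 - B)) := by
    rw [map_star_of_completelyPositive hcp, map_sub, hd.map_one]
  rw [h1]
  exact key σ _

theorem ProjectionMeasure.proj_mul_sum_mul_proj {ι : Type*} (E : ProjectionMeasure ι H)
    (T : Finset ι) (B : ι → H →L[ℂ] H) (i : ι) [Decidable (i ∈ T)] :
    E.proj i * ∑ j ∈ T, E.proj j * B j * E.proj j =
      if i ∈ T then E.proj i * B i * E.proj i else 0 := by
  classical
  rw [Finset.mul_sum]
  simp_rw [mul_assoc, ← mul_assoc (E.proj i), E.proj_mul_proj, ite_mul, zero_mul]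
  rw [Finset.sum_ite_eq]
  split_ifs <;> rfl

theorem ProjectionMeasure.sum_mul_proj {ι : Type*} (E : ProjectionMeasure ι H)
    (T : Finset ι) (B : ι → H →L[ℂ] H) (i : ι) [Decidable (i ∈ T)] :
    (∑ j ∈ T, E.proj j * B j * E.proj j) * E.proj i =
      if i ∈ T then E.proj i * B i * E.proj i else 0 := by
  classical
  rw [Finset.sum_mul]
  simp_rw [mul_assoc, E.proj_mul_proj, mul_ite, mul_zero]
  rw [Finset.sum_ite_eq']
  split_ifs <;> rfl

/-- The relative entropy decreases under pinchings. -/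
theorem relativeEntropy_pinching_le {ι : Type*} (E : ProjectionMeasure ι H)
    (τ σ : DensityOperator H) :
    relativeEntropy (pinching E τ) (pinching E σ) ≤ relativeEntropy τ σ := by
  classical
  refine relativeEntropy_le_of_forall_exists _ _ _ _ fun B ε hε => ?_
  have h1 : ∑' i, σ.weight (E.proj i) = 1 := by
    simpa [σ.weight_one] using E.tsum_weight_proj_mul σ 1
  -- The trial operator is cut to finitely many blocks. On a discarded block it is zero, at the cost
  -- `tr σ Eᵢ`, and these costs total less than `ε`.
  obtain ⟨T, hT⟩ := ((ENNReal.tendsto_tsum_compl_atTop_zero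
    (by rw [h1]; exact ENNReal.one_ne_top)).eventually_lt_const hε).exists
  have htail : ∑' i : {i // i ∉ T}, σ.weight (E.proj i) =
      ∑' i, if i ∈ T then 0 else σ.weight (E.proj i) := by
    rw [← tsum_subtype_eq_of_support_subset (s := {i | i ∉ T})]
    · refine tsum_congr fun i => ?_
      rw [if_neg i.2]
    · intro i hi hi'
      exact hi (if_pos hi')
  have hl := fun i => E.proj_mul_sum_mul_proj T (fun _ => B) i
  have hr := fun i => E.sum_mul_proj T (fun _ => B) i
  refine ⟨∑ i ∈ T, E.proj i * B * E.proj i, ?_, ?_⟩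
  · rw [← E.tsum_weight_proj_mul, weight_pinching]
    refine ENNReal.tsum_le_tsum fun i => ?_
    rw [hl]
    -- On a kept block, dropping the left factor `Eᵢ` can only increase the weight, since `Eᵢ` is a
    -- contraction.
    split_ifs
    · rw [mul_assoc]
      exact E.weight_proj_mul_le _ _ _
    · simp [DensityOperator.weight, posTrace]
  · refine le_trans ?_ (add_le_add_right hT.le _)
    rw [htail, weight_pinching, ← ENNReal.tsum_add, ← E.tsum_weight_proj_mul]
    refine ENNReal.tsum_le_tsum fun i => ?_
    have h2 : E.proj i * star (1 - ∑ i ∈ T, E.proj i * B * E.proj i) =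
        star ((1 - ∑ i ∈ T, E.proj i * B * E.proj i) * E.proj i) := by
      rw [star_mul, E.star_proj]
    rw [h2, sub_mul, hr, one_mul]
    split_ifs
    · have h3 : star (E.proj i - E.proj i * B * E.proj i) =
          E.proj i * (star (1 - B) * E.proj i) := by
        simp only [star_sub, star_mul, star_one, E.star_proj, sub_mul, mul_sub, one_mul,
          E.proj_mul_self, mul_assoc]
      rw [h3, add_zero]
      exact E.weight_proj_mul_le _ _ _
    · rw [sub_zero, E.star_proj]
      exact le_add_self

theorem ofReal_outcomeProb {ι : Type*} (E : ProjectionMeasure ι H) (τ : DensityOperator H)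
    (i : ι) : ENNReal.ofReal (outcomeProb E τ i) = τ.weight (E.proj i) := by
  have h := τ.trace_mul_star_mul (E.proj i)
  rw [E.star_proj, E.proj_mul_self] at h
  rw [outcomeProb, h, Complex.ofReal_re, ENNReal.ofReal_toReal (τ.weight_ne_top _)]

theorem outcomeProb_nonneg {ι : Type*} (E : ProjectionMeasure ι H) (τ : DensityOperator H)
    (i : ι) : 0 ≤ outcomeProb E τ i := by
  have h := τ.trace_mul_star_mul (E.proj i)
  rw [E.star_proj, E.proj_mul_self] at h
  rw [outcomeProb, h, Complex.ofReal_re]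
  exact ENNReal.toReal_nonneg

theorem tsum_outcomeProb {ι : Type*} (E : ProjectionMeasure ι H) (τ : DensityOperator H) :
    ∑' i, ENNReal.ofReal (outcomeProb E τ i) = 1 := by
  simp_rw [ofReal_outcomeProb]
  simpa [τ.weight_one] using E.tsum_weight_proj_mul τ 1

theorem outcomeProb_le_one {ι : Type*} (E : ProjectionMeasure ι H) (τ : DensityOperator H)
    (i : ι) : outcomeProb E τ i ≤ 1 := by
  rw [← ENNReal.ofReal_le_one, ← tsum_outcomeProb E τ]
  exact ENNReal.le_tsum i

/-- The relative entropy of the outcome distributions is at most that of the pinched states. -/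
theorem tsum_scalarEntropy_outcomeProb_le {ι : Type*} (E : ProjectionMeasure ι H)
    (τ σ : DensityOperator H) :
    ∑' i, scalarEntropy (outcomeProb E τ i) (outcomeProb E σ i) ≤
      relativeEntropy (pinching E τ) (pinching E σ) := by
  classical
  have h := tsum_scalarEntropy_le_relativeEntropy (pinching E τ) (pinching E σ)
    (fun _ : ι => 1) (outcomeProb E τ) (outcomeProb E σ) (fun i _ => outcomeProb_nonneg E τ i)
    (fun i _ => outcomeProb_nonneg E σ i) (by simpa using tsum_outcomeProb E τ)
    (by simpa using tsum_outcomeProb E σ) ?_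
  · simpa using h
  intro T c hc ε _
  -- The trial operator is `∑ cⱼ Eⱼ`, written as a sum of compressions to reuse the block
  -- identities. It acts on each `Eᵢ` as the scalar `cᵢ`, so both costs are attained exactly.
  have hr : ∀ i, (∑ j ∈ T, E.proj j * ((c j : ℂ) • 1) * E.proj j) * E.proj i =
      (c i : ℂ) • E.proj i := by
    intro i
    rw [E.sum_mul_proj T (fun j => (c j : ℂ) • 1) i]
    split_ifs with hi
    · rw [mul_smul_comm, smul_mul_assoc, mul_one, E.proj_mul_self]
    · rw [hc i hi]; simp
  have hl : ∀ i, E.proj i * (∑ j ∈ T, E.proj j * ((c j : ℂ) • 1) * E.proj j) =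
      (c i : ℂ) • E.proj i := by
    intro i
    rw [E.proj_mul_sum_mul_proj T (fun j => (c j : ℂ) • 1) i]
    split_ifs with hi
    · rw [mul_smul_comm, smul_mul_assoc, mul_one, E.proj_mul_self]
    · rw [hc i hi]; simp
  refine ⟨∑ j ∈ T, E.proj j * ((c j : ℂ) • 1) * E.proj j, le_of_eq ?_, le_add_right (le_of_eq ?_)⟩
  · rw [weight_pinching]
    refine tsum_congr fun i => ?_
    rw [hr, DensityOperator.weight_smul, one_mul, ofReal_outcomeProb]
  · rw [weight_pinching]
    refine tsum_congr fun i => ?_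
    have h2 : star (1 - ∑ j ∈ T, E.proj j * ((c j : ℂ) • 1) * E.proj j) * E.proj i =
        ((1 - c i : ℝ) : ℂ) • E.proj i := by
      rw [← E.star_proj i, ← star_mul, mul_sub, hl, mul_one]
      simp [sub_smul, E.star_proj]
    rw [h2, DensityOperator.weight_smul, one_mul, ofReal_outcomeProb]

end Channels

/-! ### The entropy identity behind the Holevo bound -/

section Entropy

variable {H : Type*} [NormedAddCommGroup H] [InnerProductSpace ℂ H] [CompleteSpace H]

theorem DensityOperator.weight_eigenProj (τ : DensityOperator H) (b : ℝ) :
    τ.weight (eigenProj τ.op b) = ENNReal.ofReal b * hs (eigenProj τ.op b) := by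
  rw [τ.weight_eq_tsum, tsum_eq_single b, eigenProj_mul_self]
  intro a ha
  rw [τ.eigenProj_mul_eigenProj ha.symm, hs_zero, mul_zero]

theorem vonNeumannEntropy_eq_tsum_overlap (τ σ : DensityOperator H) :
    vonNeumannEntropy τ =
      ∑' j : ℝ × ℝ, overlap τ σ j.1 j.2 * ENNReal.ofReal (Real.negMulLog j.1) := by
  rw [ENNReal.tsum_prod' (f := fun j : ℝ × ℝ =>
    overlap τ σ j.1 j.2 * ENNReal.ofReal (Real.negMulLog j.1)), vonNeumannEntropy]
  refine tsum_congr fun a => ?_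
  simp only
  rw [ENNReal.tsum_mul_right, posTrace_eigenProj, mul_comm]
  congr 1
  exact (σ.spectralMeasure.tsum_hs_proj_mul _).symm

theorem vonNeumannEntropy_eq_tsum_weight (τ : DensityOperator H) :
    vonNeumannEntropy τ =
      ∑' b : ℝ, ENNReal.ofReal (-Real.log b) * τ.weight (eigenProj τ.op b) := by
  refine tsum_congr fun b => ?_
  rw [τ.weight_eigenProj, posTrace_eigenProj, ← mul_assoc]
  rcases le_or_gt 0 b with hb | hb
  · rw [← ENNReal.ofReal_mul' hb, Real.negMulLog]
    congr 2
    ring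
  · simp [τ.eigenProj_of_neg hb, hs_zero]

/-- `S(τ, σ) + S(τ) = - tr τ log σ` when the support of `τ` lies in that of `σ`. -/
theorem relativeEntropy_add_vonNeumannEntropy (τ σ : DensityOperator H)
    (h : ∀ a : ℝ, a ≠ 0 → overlap τ σ a 0 = 0) :
    relativeEntropy τ σ + vonNeumannEntropy τ =
      ∑' b : ℝ, ENNReal.ofReal (-Real.log b) * τ.weight (eigenProj σ.op b) := by
  have h1 : ∑' b : ℝ, ENNReal.ofReal (-Real.log b) * τ.weight (eigenProj σ.op b) =
      ∑' j : ℝ × ℝ,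
        ENNReal.ofReal (-Real.log j.2) * (overlap τ σ j.1 j.2 * ENNReal.ofReal j.1) := by
    rw [ENNReal.tsum_prod' (f := fun j : ℝ × ℝ =>
      ENNReal.ofReal (-Real.log j.2) * (overlap τ σ j.1 j.2 * ENNReal.ofReal j.1)),
      ENNReal.tsum_comm]
    refine tsum_congr fun b => ?_
    simp only
    rw [ENNReal.tsum_mul_left, τ.weight_eq_tsum]
    simp only [overlap, mul_comm]
  -- The same `1` is added to both sides, as `∑ tr (Pₐ Q_b) a` on the left and `∑ tr (Pₐ Q_b) b` on
  -- the right. This compensates the term `b - a`, and the two sums then agree termwise.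
  refine (ENNReal.add_left_inj ENNReal.one_ne_top).1 ?_
  nth_rewrite 1 [← tsum_overlap_left τ σ]
  rw [← tsum_overlap_right τ σ, h1, relativeEntropy_eq_tsum, vonNeumannEntropy_eq_tsum_overlap τ σ,
    ← ENNReal.tsum_add, ← ENNReal.tsum_add, ← ENNReal.tsum_add]
  refine tsum_congr fun ⟨a, b⟩ => ?_
  simp only
  by_cases hm : overlap τ σ a b = 0
  · simp [hm]
  have ha := nonneg_left_of_overlap_ne_zero hm
  -- Eigenvalues at most one give `-log b` and `- a log a` the right sign, so `ENNReal.ofReal`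
  -- truncates nothing.
  have ha1 : a ≤ 1 := by
    by_contra hlt
    exact hm (by rw [overlap, τ.eigenProj_of_one_lt (not_le.1 hlt), mul_zero, hs_zero])
  have hb1 : b ≤ 1 := by
    by_contra hlt
    exact hm (by rw [overlap, σ.eigenProj_of_one_lt (not_le.1 hlt), zero_mul, hs_zero])
  rcases eq_or_lt_of_le (nonneg_right_of_overlap_ne_zero hm) with rfl | hb
  · have ha0 : a = 0 := by
      by_contra ha0
      exact hm (h a ha0)
    simp [ha0, scalarEntropy_zero_zero]
  · have hlb : 0 ≤ -Real.log b := neg_nonneg.2 (Real.log_nonpos hb.le hb1)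
    have hla : 0 ≤ Real.negMulLog a := Real.negMulLog_nonneg ha ha1
    rw [mul_left_comm, ← ENNReal.ofReal_mul hlb, ← mul_add, ← mul_add, ← mul_add,
      scalarEntropy_of_pos ha hb, ← ENNReal.ofReal_add (mul_log_sub_log_nonneg ha hb) hla,
      ← ENNReal.ofReal_add (add_nonneg (mul_log_sub_log_nonneg ha hb) hla) ha,
      ← ENNReal.ofReal_add (mul_nonneg hlb ha) hb.le]
    congr 2
    rw [Real.negMulLog]
    ring

/-- The mixture gives its own kernel projection probability zero; every component of positive weight
must then do so too, so its support lies in that of the mixture. -/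
theorem overlap_codingChannel {κ : Type*} (σ : κ → DensityOperator H) (ρ : PMF κ) {k : κ}
    (hk : ρ k ≠ 0) {a : ℝ} (ha : a ≠ 0) : overlap (σ k) (codingChannel σ ρ) a 0 = 0 := by
  have h1 := (codingChannel σ ρ).weight_eigenProj 0
  rw [ENNReal.ofReal_zero, zero_mul, weight_codingChannel, ENNReal.tsum_eq_zero] at h1
  have h2 := (mul_eq_zero.1 (h1 k)).resolve_left hk
  rw [DensityOperator.weight_eq_tsum, ENNReal.tsum_eq_zero] at h2
  by_contra hm
  have ha' : 0 < a := lt_of_le_of_ne (nonneg_left_of_overlap_ne_zero hm) ha.symm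
  rcases mul_eq_zero.1 (h2 a) with h3 | h3
  · exact absurd (ENNReal.ofReal_eq_zero.1 h3) (not_le.2 ha')
  · exact hm h3

/-- Each component contributes `- tr σₖ log σ`, which is affine in `σₖ`; averaging gives `- tr σ log
σ`. -/
theorem tsum_relativeEntropy_add_tsum_vonNeumannEntropy {κ : Type*} (σ : κ → DensityOperator H)
    (ρ : PMF κ) :
    (∑' k, ρ k * relativeEntropy (σ k) (codingChannel σ ρ)) +
      (∑' k, ρ k * vonNeumannEntropy (σ k)) = vonNeumannEntropy (codingChannel σ ρ) := by
  rw [← ENNReal.tsum_add, vonNeumannEntropy_eq_tsum_weight (codingChannel σ ρ)]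
  simp_rw [weight_codingChannel, ← ENNReal.tsum_mul_left]
  rw [ENNReal.tsum_comm]
  refine tsum_congr fun k => ?_
  by_cases hk : ρ k = 0
  · simp [hk]
  rw [← mul_add, relativeEntropy_add_vonNeumannEntropy _ _ fun a ha =>
    overlap_codingChannel σ ρ hk ha, ← ENNReal.tsum_mul_left]
  exact tsum_congr fun b => mul_left_comm _ _ _

end Entropy

/-! ### Mutual entropy of a classical input -/

section Mutual

variable {H : Type*} [NormedAddCommGroup H] [InnerProductSpace ℂ H] [CompleteSpace H]
  {κ : Type*}

theorem tsum_pure_mul (k : κ) (f : κ → ℝ≥0∞) : ∑' j, PMF.pure k j * f j = f k := by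
  rw [tsum_eq_single k]
  · simp
  · intro j hj
    rw [PMF.pure_apply_of_ne _ _ hj, zero_mul]

theorem codingChannel_pure (σ : κ → DensityOperator H) (k : κ) :
    codingChannel σ (PMF.pure k) = σ k := by
  refine DensityOperator.ext' ?_
  change ∑' j, ((PMF.pure k j).toReal : ℂ) • (σ j).op = _
  rw [tsum_eq_single k]
  · simp
  · intro j hj
    rw [PMF.pure_apply_of_ne _ _ hj]
    simp

theorem pmf_pure_injective : Function.Injective (PMF.pure : κ → PMF κ) := by
  intro j k h
  by_contra hne
  have h1 := congrArg (fun p : PMF κ => p j) h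
  simp only [PMF.pure_apply_self, PMF.pure_apply_of_ne _ _ hne] at h1
  exact one_ne_zero h1

/-- The decomposition of a probability distribution into all point masses. -/
noncomputable def pureDecomposition (p : PMF κ) : ClassicalSchattenDecomposition p where
  states := Set.range PMF.pure
  isPure := by
    rintro _ ⟨k, rfl⟩
    exact ⟨k, rfl⟩
  weight e := p ((Equiv.ofInjective _ pmf_pure_injective).symm e)
  eq_sum x := by
    rw [← (Equiv.ofInjective _ pmf_pure_injective).tsum_eq, tsum_eq_single x]
    · simp
    · intro k hk
      simp [PMF.pure_apply_of_ne _ _ hk.symm]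

/-- Substituting `p = ∑ wₑ e` into the right side shows that every decomposition into point masses
gives this value. The supremum is over a constant, and `pureDecomposition` ensures that the family
is nonempty. -/
theorem mutualEntropy_eq_tsum (p : PMF κ) (Λ : PMF κ → DensityOperator H) :
    mutualEntropy p Λ = ∑' k, p k * relativeEntropy (Λ (PMF.pure k)) (Λ p) := by
  have h : ∀ D : ClassicalSchattenDecomposition p,
      ∑' e : D.states, D.weight e * relativeEntropy (Λ e.1) (Λ p) =
        ∑' k, p k * relativeEntropy (Λ (PMF.pure k)) (Λ p) := by
    intro D
    simp_rw [D.eq_sum, ← ENNReal.tsum_mul_right]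
    rw [ENNReal.tsum_comm]
    refine tsum_congr fun e => ?_
    obtain ⟨k, hk⟩ := D.isPure e.1 e.2
    simp_rw [hk, mul_assoc]
    rw [ENNReal.tsum_mul_left,
      tsum_pure_mul k fun j => relativeEntropy (Λ (PMF.pure j)) (Λ p)]
  have : Nonempty (ClassicalSchattenDecomposition p) := ⟨pureDecomposition p⟩
  rw [mutualEntropy]
  simp_rw [h]
  exact iSup_const

end Mutual

/-! ### The classical bracket for one outcome -/

section Outcome

variable {κ : Type*} (ρ : PMF κ) {p : κ → ℝ} {q : ℝ}

theorem PMF_hasSum_toReal : HasSum (fun k => (ρ k).toReal) 1 := by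
  have h := ENNReal.hasSum_toReal ρ.tsum_coe_ne_top
  rwa [← ENNReal.tsum_toReal_eq ρ.apply_ne_top, ρ.tsum_coe, ENNReal.toReal_one] at h

theorem summable_toReal_mul_mul_log (hp0 : ∀ k, 0 ≤ p k) (hp1 : ∀ k, p k ≤ 1) :
    Summable fun k => (ρ k).toReal * (p k * Real.log (p k)) := by
  refine Summable.of_norm_bounded (PMF_hasSum_toReal ρ).summable fun k => ?_
  rw [norm_mul, Real.norm_of_nonneg ENNReal.toReal_nonneg]
  refine mul_le_of_le_one_right ENNReal.toReal_nonneg ?_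
  rcases eq_or_lt_of_le (hp0 k) with h | h
  · simp [← h]
  · rw [mul_comm]
    exact (Real.abs_log_mul_self_lt _ h (hp1 k)).le

theorem hasSum_toReal_mul (hp0 : ∀ k, 0 ≤ p k) (hq0 : 0 ≤ q)
    (hq : ENNReal.ofReal q = ∑' k, ρ k * ENNReal.ofReal (p k)) :
    HasSum (fun k => (ρ k).toReal * p k) q := by
  have h := ENNReal.hasSum_toReal (f := fun k => ρ k * ENNReal.ofReal (p k))
    (by rw [← hq]; exact ENNReal.ofReal_ne_top)
  rw [← ENNReal.tsum_toReal_eq fun k =>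
    ENNReal.mul_ne_top (ρ.apply_ne_top k) ENNReal.ofReal_ne_top, ← hq,
    ENNReal.toReal_ofReal hq0] at h
  simpa only [ENNReal.toReal_mul, ENNReal.toReal_ofReal (hp0 _)] using h

/-- The mean of `p` is `q`, so the terms `q - p` cancel in the average and the cross term becomes `q
log q`. The bracket is therefore a sum of relative entropy terms. -/
theorem hasSum_toReal_mul_log_sub_log (hp0 : ∀ k, 0 ≤ p k) (hp1 : ∀ k, p k ≤ 1)
    (hq0 : 0 ≤ q)
    (hq : ENNReal.ofReal q = ∑' k, ρ k * ENNReal.ofReal (p k)) :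
    HasSum (fun k => (ρ k).toReal * (p k * (Real.log (p k) - Real.log q) + q - p k))
      (-(q * Real.log q) + ∑' k, (ρ k).toReal * (p k * Real.log (p k))) := by
  have h1 := (summable_toReal_mul_mul_log ρ hp0 hp1).hasSum
  have h2 := hasSum_toReal_mul ρ hp0 hq0 hq
  have h3 := ((h1.sub (h2.mul_right (Real.log q))).add
    ((PMF_hasSum_toReal ρ).mul_right q)).sub h2
  refine (congrArg₂ (fun f x => HasSum f x) (funext fun k => ?_) ?_).mp h3 <;> ring

theorem toReal_mul_log_sub_log_nonneg (hp0 : ∀ k, 0 ≤ p k) (hq0 : 0 ≤ q)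
    (hq : ENNReal.ofReal q = ∑' k, ρ k * ENNReal.ofReal (p k))
    (k : κ) :
    0 ≤ (ρ k).toReal * (p k * (Real.log (p k) - Real.log q) + q - p k) := by
  -- If the mean `q` vanishes, so does every product `ρ k * p k`, and the term is zero.
  rcases eq_or_lt_of_le hq0 with h | h
  · have h1 : ρ k * ENNReal.ofReal (p k) = 0 := by
      rw [← h, ENNReal.ofReal_zero] at hq
      exact ENNReal.tsum_eq_zero.1 hq.symm k
    rcases mul_eq_zero.1 h1 with h1 | h1
    · simp [h1]
    · simp [le_antisymm (ENNReal.ofReal_eq_zero.1 h1) (hp0 k), ← h]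
  · exact mul_nonneg ENNReal.toReal_nonneg (mul_log_sub_log_nonneg (hp0 k) h)

theorem entropy_gain_nonneg (hp0 : ∀ k, 0 ≤ p k) (hp1 : ∀ k, p k ≤ 1)
    (hq0 : 0 ≤ q)
    (hq : ENNReal.ofReal q = ∑' k, ρ k * ENNReal.ofReal (p k)) :
    0 ≤ -(q * Real.log q) + ∑' k, (ρ k).toReal * (p k * Real.log (p k)) :=
  (hasSum_toReal_mul_log_sub_log ρ hp0 hp1 hq0 hq).nonneg
    (toReal_mul_log_sub_log_nonneg ρ hp0 hq0 hq)

theorem ofReal_entropy_gain_le (hp0 : ∀ k, 0 ≤ p k) (hp1 : ∀ k, p k ≤ 1)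
    (hq0 : 0 ≤ q)
    (hq : ENNReal.ofReal q = ∑' k, ρ k * ENNReal.ofReal (p k)) :
    ENNReal.ofReal (-(q * Real.log q) + ∑' k, (ρ k).toReal * (p k * Real.log (p k))) ≤
      ∑' k, ρ k * scalarEntropy (p k) q := by
  have h := hasSum_toReal_mul_log_sub_log ρ hp0 hp1 hq0 hq
  rw [← h.tsum_eq, ENNReal.ofReal_tsum_of_nonneg
    (toReal_mul_log_sub_log_nonneg ρ hp0 hq0 hq) h.summable]
  refine ENNReal.tsum_le_tsum fun k => ?_
  rw [ENNReal.ofReal_mul ENNReal.toReal_nonneg, ENNReal.ofReal_toReal (ρ.apply_ne_top k)]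
  gcongr
  exact ofReal_le_scalarEntropy (hp0 k) hq0

end Outcome

/-! ### Assembling the inequalities -/

section Main

variable {H H' : Type*} [NormedAddCommGroup H] [InnerProductSpace ℂ H] [CompleteSpace H]
  [NormedAddCommGroup H'] [InnerProductSpace ℂ H'] [CompleteSpace H'] {κ ι : Type*}

/-- The double sum is `C* C` with `C = ∑ Bₖ Aₖ`. This makes the case of trivial `Γ₂` an instance of
the general one. -/
theorem isCompletelyPositiveChannel_id :
    IsCompletelyPositiveChannel (id : DensityOperator H → DensityOperator H) := by
  refine ⟨LinearMap.id, fun _ _ => rfl, fun n A B => ?_⟩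
  have h : ∑ k, ∑ j, star (A k) *
      (LinearMap.id : (H →L[ℂ] H) →ₗ[ℂ] (H →L[ℂ] H)) (star (B k) * B j) * A j =
      star (∑ k, B k * A k) * ∑ j, B j * A j := by
    rw [star_sum, Finset.sum_mul]
    refine Finset.sum_congr rfl fun k _ => ?_
    rw [Finset.mul_sum]
    refine Finset.sum_congr rfl fun j _ => ?_
    simp only [LinearMap.id_apply, star_mul, mul_assoc]
  rw [h, ContinuousLinearMap.star_eq_adjoint]
  exact ContinuousLinearMap.isPositive_adjoint_comp_self _

theorem mutualEntropy_pinching_comp (ρ : PMF κ) (σ : κ → DensityOperator H)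
    (E : ProjectionMeasure ι H') (Λ : DensityOperator H → DensityOperator H') :
    mutualEntropy ρ (pinching E ∘ Λ ∘ codingChannel σ) =
      ∑' k, ρ k * relativeEntropy (pinching E (Λ (σ k)))
        (pinching E (Λ (codingChannel σ ρ))) := by
  rw [mutualEntropy_eq_tsum]
  simp only [Function.comp_apply, codingChannel_pure]

theorem mutualEntropy_pinching_comp_le (ρ : PMF κ) (σ : κ → DensityOperator H)
    (E : ProjectionMeasure ι H') {Λ : DensityOperator H → DensityOperator H'}
    (hΛ : IsCompletelyPositiveChannel Λ) :
    mutualEntropy ρ (pinching E ∘ Λ ∘ codingChannel σ) ≤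
      ∑' k, ρ k * relativeEntropy (σ k) (codingChannel σ ρ) := by
  rw [mutualEntropy_pinching_comp]
  refine ENNReal.tsum_le_tsum fun k => ?_
  gcongr
  exact (relativeEntropy_pinching_le E _ _).trans (hΛ.relativeEntropy_le _ _)

theorem ofReal_outcomeProb_codingChannel (ρ : PMF κ) (σ : κ → DensityOperator H)
    (E : ProjectionMeasure ι H') {Λ : DensityOperator H → DensityOperator H'}
    (hΛ : IsCompletelyPositiveChannel Λ) (i : ι) :
    ENNReal.ofReal (outcomeProb E (Λ (codingChannel σ ρ)) i) =
      ∑' k, ρ k * ENNReal.ofReal (outcomeProb E (Λ (σ k)) i) := by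
  obtain ⟨S, hS⟩ := hΛ.exists_weight_eq (E.proj i)
  simp_rw [ofReal_outcomeProb, hS]
  exact weight_codingChannel σ ρ S

theorem tsum_ofReal_entropy_gain_le (ρ : PMF κ) (σ : κ → DensityOperator H)
    (E : ProjectionMeasure ι H') {Λ : DensityOperator H → DensityOperator H'}
    (hΛ : IsCompletelyPositiveChannel Λ) :
    ∑' i, ENNReal.ofReal
        (-(outcomeProb E (Λ (codingChannel σ ρ)) i *
            Real.log (outcomeProb E (Λ (codingChannel σ ρ)) i)) +
          ∑' k, (ρ k).toReal *
            (outcomeProb E (Λ (σ k)) i * Real.log (outcomeProb E (Λ (σ k)) i))) ≤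
      mutualEntropy ρ (pinching E ∘ Λ ∘ codingChannel σ) := by
  calc _ ≤ ∑' i, ∑' k, ρ k * scalarEntropy (outcomeProb E (Λ (σ k)) i)
        (outcomeProb E (Λ (codingChannel σ ρ)) i) :=
        ENNReal.tsum_le_tsum fun i => ofReal_entropy_gain_le ρ
          (fun k => outcomeProb_nonneg E _ i) (fun k => outcomeProb_le_one E _ i)
          (outcomeProb_nonneg E _ i) (ofReal_outcomeProb_codingChannel ρ σ E hΛ i)
    _ = ∑' k, ρ k * ∑' i, scalarEntropy (outcomeProb E (Λ (σ k)) i)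
        (outcomeProb E (Λ (codingChannel σ ρ)) i) := by
        rw [ENNReal.tsum_comm]
        simp_rw [ENNReal.tsum_mul_left]
    _ ≤ _ := by
        rw [mutualEntropy_pinching_comp]
        refine ENNReal.tsum_le_tsum fun k => ?_
        gcongr
        exact tsum_scalarEntropy_outcomeProb_le E _ _

theorem mutualEntropy_pinching_comp_codingChannel_le (ρ : PMF κ) (σ : κ → DensityOperator H)
    (E : ProjectionMeasure ι H) :
    mutualEntropy ρ (pinching E ∘ codingChannel σ) ≤
      ∑' k, ρ k * relativeEntropy (σ k) (codingChannel σ ρ) := by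
  have h := mutualEntropy_pinching_comp_le ρ σ E (isCompletelyPositiveChannel_id (H := H))
  rwa [Function.id_comp] at h

theorem tsum_ofReal_entropy_gain_codingChannel_le (ρ : PMF κ) (σ : κ → DensityOperator H)
    (E : ProjectionMeasure ι H) :
    ∑' i, ENNReal.ofReal
        (-(outcomeProb E (codingChannel σ ρ) i *
            Real.log (outcomeProb E (codingChannel σ ρ) i)) +
          ∑' k, (ρ k).toReal *
            (outcomeProb E (σ k) i * Real.log (outcomeProb E (σ k) i))) ≤
      mutualEntropy ρ (pinching E ∘ codingChannel σ) := by
  have h := tsum_ofReal_entropy_gain_le ρ σ E (isCompletelyPositiveChannel_id (H := H))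
  rw [Function.id_comp] at h
  simpa only [id_eq] using h

end Main

end QuantumInfo

open QuantumInfo in
theorem mainTheorem1 {H H' : Type*}
    [NormedAddCommGroup H] [InnerProductSpace ℂ H] [CompleteSpace H]
    [NormedAddCommGroup H'] [InnerProductSpace ℂ H'] [CompleteSpace H']
    {κ ι : Type*} (ρ : PMF κ) (σ : κ → DensityOperator H) :
    -- the general inequalities, for `Γ = Γ₁ ∘ Γ₂` with `Γ₁` the pinching by `E`
    (∀ (E : ProjectionMeasure ι H') (Γ₂ : DensityOperator H → DensityOperator H'),
      IsCompletelyPositiveChannel Γ₂ →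
        mutualEntropy ρ (pinching E ∘ Γ₂ ∘ codingChannel σ) ≤
            ∑' k, ρ k * relativeEntropy (σ k) (codingChannel σ ρ) ∧
        mutualEntropy ρ (pinching E ∘ Γ₂ ∘ codingChannel σ) =
            ∑' k, ρ k * relativeEntropy (pinching E (Γ₂ (σ k)))
              (pinching E (Γ₂ (codingChannel σ ρ))) ∧
        (∀ i, Summable fun k => (ρ k).toReal *
            (outcomeProb E (Γ₂ (σ k)) i * Real.log (outcomeProb E (Γ₂ (σ k)) i))) ∧
        (∀ i, 0 ≤ -(outcomeProb E (Γ₂ (codingChannel σ ρ)) i *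
              Real.log (outcomeProb E (Γ₂ (codingChannel σ ρ)) i)) +
            ∑' k, (ρ k).toReal *
              (outcomeProb E (Γ₂ (σ k)) i * Real.log (outcomeProb E (Γ₂ (σ k)) i))) ∧
        ∑' i, ENNReal.ofReal
            (-(outcomeProb E (Γ₂ (codingChannel σ ρ)) i *
                Real.log (outcomeProb E (Γ₂ (codingChannel σ ρ)) i)) +
              ∑' k, (ρ k).toReal *
                (outcomeProb E (Γ₂ (σ k)) i * Real.log (outcomeProb E (Γ₂ (σ k)) i))) ≤
          mutualEntropy ρ (pinching E ∘ Γ₂ ∘ codingChannel σ)) ∧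
    -- the case of trivial `Γ₂`: the Holevo bound
    ((∑' k, ρ k * relativeEntropy (σ k) (codingChannel σ ρ)) +
        (∑' k, ρ k * vonNeumannEntropy (σ k)) = vonNeumannEntropy (codingChannel σ ρ)) ∧
    (∀ E : ProjectionMeasure ι H,
        mutualEntropy ρ (pinching E ∘ codingChannel σ) ≤
            ∑' k, ρ k * relativeEntropy (σ k) (codingChannel σ ρ) ∧
        ∑' i, ENNReal.ofReal
            (-(outcomeProb E (codingChannel σ ρ) i *
                Real.log (outcomeProb E (codingChannel σ ρ) i)) +
              ∑' k, (ρ k).toReal *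
                (outcomeProb E (σ k) i * Real.log (outcomeProb E (σ k) i))) ≤
          mutualEntropy ρ (pinching E ∘ codingChannel σ)) := by
  refine ⟨fun E Γ₂ hΓ => ?_, tsum_relativeEntropy_add_tsum_vonNeumannEntropy σ ρ, fun E => ?_⟩
  · refine ⟨?_, ?_, fun i => ?_, fun i => ?_, ?_⟩
    · exact mutualEntropy_pinching_comp_le ρ σ E hΓ
    · exact mutualEntropy_pinching_comp ρ σ E Γ₂
    · exact summable_toReal_mul_mul_log ρ (fun k => outcomeProb_nonneg E _ i)
        fun k => outcomeProb_le_one E _ i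
    · exact entropy_gain_nonneg ρ (fun k => outcomeProb_nonneg E _ i)
        (fun k => outcomeProb_le_one E _ i) (outcomeProb_nonneg E _ i)
        (ofReal_outcomeProb_codingChannel ρ σ E hΓ i)
    · exact tsum_ofReal_entropy_gain_le ρ σ E hΓ
  · refine ⟨?_, ?_⟩
    · exact mutualEntropy_pinching_comp_codingChannel_le ρ σ E
    · exact tsum_ofReal_entropy_gain_codingChannel_le ρ σ E
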